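/- A birational map $\phi=(\phi_0:\phi_1:\phi_2)$ of $\mathbb{P}^2_{\mathbb{C}}$ is written with homogeneous polynomials $\phi_i$ of the same degree and without common factor; that degree is $\deg\phi$, and $\phi$ is quadratic if $\deg\phi=2$. The orbit of $\phi$ is $\mathscr{O}(\phi)=\{\ell\circ\phi\circ\ell' \mid \ell,\ell'\in\mathrm{Aut}(\mathbb{P}^2_{\mathbb{C}})\}$. Let $$\rho\colon(x:y:z)\dashrightarrow(xy:z^2:yz),\qquad \tau\colon(x:y:z)\dashrightarrow(x^2:xy:y^2-xz).$$ A foliation $\mathcal{F}$ of degree $d$ on $\mathbb{P}^2_{\mathbb{C}}$ is given, up to a nonzero constant, by a homogeneous $1$-form $\omega=A\,\mathrm{d}x+B\,\mathrm{d}y+C\,\mathrm{d}z$ with $A,B,C$ homogeneous of degree $d+1$ without common factor and $xA+yB+zC=0$. For a birational map $\phi$, the foliation $\phi^*\mathcal{F}$ is given by $\phi^*\omega$ divided by the common factor of its coefficients. $\mathcal{F}$ is primitive if $\deg\mathcal{F}\le\deg\phi^*\mathcal{F}$ for every birational map $\phi$ of $\mathbb{P}^2_{\mathbb{C}}$. A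 rational first integral of $\mathcal{F}$ is a nonconstant rational function $f$ on $\mathbb{P}^2_{\mathbb{C}}$ with $\mathrm{d}f\wedge\omega=0$. Let $\mathcal{F}_{\Omega_1},\dots,\mathcal{F}_{\Omega_4}$ be the foliations of degree $2$ on $\mathbb{P}^2_{\mathbb{C}}$ given in the affine chart $z=1$ by $$\Omega_1=x^2\,\mathrm{d}x+y^2(x\,\mathrm{d}y-y\,\mathrm{d}x),\qquad \Omega_2=x^2\,\mathrm{d}x+(x+y^2)(x\,\mathrm{d}y-y\,\mathrm{d}x),$$ $$\Omega_3=xy\,\mathrm{d}x+(x^2+y^2)(x\,\mathrm{d}y-y\,\mathrm{d}x),\qquad \Omega_4=(x+y^2-x^2y)\,\mathrm{d}y+x(x+y^2)\,\mathrm{d}x.$$ **Proposition.** 1. There is a quadratic birational map $\psi_1\in\mathscr{O}(\rho)$ such that $\deg\psi_1^*\mathcal{F}_{\Omega_1}=2$; furthermore $\mathcal{F}_{\Omega_1}$ has a rational first integral and is not primitive. 2. For $k=2,3$ there is no birational map $\varphi_k$ such that $\deg\varphi_k^*\mathcal{F}_{\Omega_k}=0$, but there is $\psi_k\in\mathscr{O}(\tau)$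 such that $\deg\psi_k^*\mathcal{F}_{\Omega_k}=1$. In particular $\mathcal{F}_{\Omega_2}$ and $\mathcal{F}_{\Omega_3}$ are not primitive. 3. There is a quadratic birational map $\psi_4\in\mathscr{O}(\tau)$ such that $\deg\psi_4^*\mathcal{F}_{\Omega_4}=3$, and $\mathcal{F}_{\Omega_4}$ is primitive. -/

import Mathlib

namespace CremonaFoliation

open MvPolynomial

/-- Polynomials in the homogeneous coordinates `x = X 0`, `y = X 1`, `z = X 2` of the complex
projective plane. -/
abbrev Poly : Type := MvPolynomial (Fin 3) ℂ

/-- A triple of polynomials without common factor. -/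
def NoCommonFactor (f : Fin 3 → Poly) : Prop :=
  ∀ p : Poly, (∀ i, p ∣ f i) → IsUnit p

/-- A rational map of the projective plane, given by three homogeneous polynomials of the same
degree without common factor. Two such triples define the same map iff they differ by a nonzero
constant. -/
structure RationalMap where
  degree : ℕ
  coord : Fin 3 → Poly
  homogeneous : ∀ i, (coord i).IsHomogeneous degree
  coprime : NoCommonFactor coord

/-- `φ ∘ ψ = id` as rational maps: substituting `ψ` in `φ` gives `P · (x, y, z)`, `P ≠ 0`. -/
def RationalMap.CompEqId (φ ψ : RationalMap) : Prop :=
  ∃ P : Poly, P ≠ 0 ∧ ∀ i, bind₁ ψ.coord (φ.coord i) = P * X i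

/-- A birational map of the projective plane. -/
structure BirationalMap extends RationalMap where
  birational : ∃ ψ : RationalMap, toRationalMap.CompEqId ψ ∧ ψ.CompEqId toRationalMap

/-- The linear forms which are the coordinates of the automorphism of the projective plane
defined by an invertible matrix. -/
noncomputable def linearCoord (A : GL (Fin 3) ℂ) (i : Fin 3) : Poly :=
  ∑ j, C ((A : Matrix (Fin 3) (Fin 3) ℂ) i j) * X j

/-- The orbit of `φ`: all the birational maps `ℓ ∘ φ ∘ ℓ'` with `ℓ`, `ℓ'` automorphisms of the
projective plane (`A` is a matrix of `ℓ` and `B` is a matrix of `ℓ'`). -/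
def orbit (φ : BirationalMap) : Set BirationalMap :=
  {ψ | ∃ A B : GL (Fin 3) ℂ, ∀ i,
    ψ.coord i = bind₁ (fun j => bind₁ (linearCoord B) (φ.coord j)) (linearCoord A i)}

/-- A foliation of degree `degree` on the complex projective plane: it is defined by a homogeneous
1-form `form 0 dx + form 1 dy + form 2 dz`, whose coefficients are homogeneous of degree
`degree + 1` and have no common factor, and which is annihilated by the radial vector field.
Integrability is automatic in three variables for such forms. Two such forms define the same
foliation iff they differ by a nonzero constant. -/
structure Foliation where
  degree : ℕ
  form : Fin 3 → Poly
  homogeneous : ∀ i, (form i).IsHomogeneous (degree + 1)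
  radial : ∑ i, X i * form i = 0
  coprime : NoCommonFactor form

/-- The pull-back of the 1-form `∑ ωᵢ dxᵢ` by the polynomial map `f`. -/
noncomputable def pullbackForm (f ω : Fin 3 → Poly) (j : Fin 3) : Poly :=
  ∑ i, bind₁ f (ω i) * pderiv j (f i)

/-- `G` is the pull-back `φ^* F`: the pull-back by `φ` of a 1-form defining `F` is a multiple of a
1-form defining `G`. -/
def IsPullback (φ : BirationalMap) (F G : Foliation) : Prop :=
  ∃ P : Poly, P ≠ 0 ∧ ∀ j, pullbackForm φ.coord F.form j = P * G.form j

/-! ### Existence of the pull-back and uniqueness of its degree -/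

theorem NoCommonFactor.exists_ne_zero {f : Fin 3 → Poly} (h : NoCommonFactor f) :
    ∃ i, f i ≠ 0 := by
  by_contra! h0
  exact not_isUnit_zero (h 0 fun i => by rw [h0 i])

theorem weight_one_eq (d : Fin 3 →₀ ℕ) :
    Finsupp.weight (1 : Fin 3 → ℕ) d = Finsupp.degree d :=
  (DFunLike.congr_fun (Finsupp.degree_eq_weight_one (R := ℕ)) d).symm

theorem isHomogeneous_of_mul {p q : Poly} {n : ℕ} (hp : p ≠ 0) (hq : q ≠ 0)
    (h : (p * q).IsHomogeneous n) : q.IsHomogeneous q.totalDegree := by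
  have hord : ∀ r : Poly, r ≠ 0 → ∃ m : ℕ, (r : MvPowerSeries (Fin 3) ℂ).order = m ∧
      m ≤ r.totalDegree := by
    intro r hr
    obtain ⟨d, hd⟩ := MvPolynomial.ne_zero_iff.1 hr
    have h1 : (r : MvPowerSeries (Fin 3) ℂ).order ≤ (Finsupp.degree d : ℕ) :=
      MvPowerSeries.order_le (by simpa using hd)
    have h2 : Finsupp.degree d ≤ r.totalDegree :=
      MvPolynomial.le_totalDegree (MvPolynomial.mem_support_iff.2 hd)
    obtain ⟨m, hm⟩ := ENat.ne_top_iff_exists.1 (ne_top_of_le_ne_top (ENat.natCast_ne_top _) h1)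
    refine ⟨m, hm.symm, le_trans ?_ h2⟩
    rw [← hm] at h1
    exact_mod_cast h1
  obtain ⟨a, ha, ha'⟩ := hord p hp
  obtain ⟨b, hb, hb'⟩ := hord q hq
  have hpq : p * q ≠ 0 := mul_ne_zero hp hq
  have htd : p.totalDegree + q.totalDegree = n := by
    rw [← totalDegree_mul_of_isDomain hp hq]
    exact h.totalDegree hpq
  have hn : n ≤ a + b := by
    have h3 : ((p * q : Poly) : MvPowerSeries (Fin 3) ℂ).order = (a + b : ℕ) := by
      rw [MvPolynomial.coe_mul, MvPowerSeries.order_mul, ha, hb]; push_cast; rfl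
    have h4 : (n : ℕ∞) ≤ ((p * q : Poly) : MvPowerSeries (Fin 3) ℂ).order := by
      refine MvPowerSeries.nat_le_order fun d hd => ?_
      rw [MvPolynomial.coeff_coe]
      by_contra hne
      have := h hne
      rw [weight_one_eq] at this
      omega
    rw [h3] at h4
    exact_mod_cast h4
  have hbq : b = q.totalDegree := by omega
  intro d hd
  rw [weight_one_eq]
  have h2 : Finsupp.degree d ≤ q.totalDegree :=
    MvPolynomial.le_totalDegree (MvPolynomial.mem_support_iff.2 hd)
  have h1 : (q : MvPowerSeries (Fin 3) ℂ).order ≤ (Finsupp.degree d : ℕ) :=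
    MvPowerSeries.order_le (by simpa using hd)
  rw [hb] at h1
  have h1' : b ≤ Finsupp.degree d := by exact_mod_cast h1
  omega

theorem pderiv_bind₁ (f : Fin 3 → Poly) (p : Poly) (j : Fin 3) :
    pderiv j (bind₁ f p) = ∑ i, bind₁ f (pderiv i p) * pderiv j (f i) := by
  induction p using MvPolynomial.induction_on with
  | C a => simp
  | add p q hp hq => simp [hp, hq, add_mul, Finset.sum_add_distrib]
  | mul_X p k hp =>
    have h1 : ∀ i, bind₁ f (pderiv i (p * X k)) * pderiv j (f i) =
        f k * (bind₁ f (pderiv i p) * pderiv j (f i)) +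
          (if i = k then bind₁ f p * pderiv j (f i) else 0) := by
      intro i
      rw [pderiv_mul]
      by_cases hik : i = k
      · subst hik
        rw [pderiv_X_self, if_pos rfl, map_add, map_mul, map_mul, bind₁_X_right, map_one]
        ring
      · rw [pderiv_X_of_ne (Ne.symm hik), if_neg hik, map_add, map_mul, map_mul, bind₁_X_right,
          map_zero]
        ring
    simp_rw [h1]
    rw [Finset.sum_add_distrib, ← Finset.mul_sum, ← hp, map_mul, bind₁_X_right, pderiv_mul,
      Finset.sum_ite_eq' Finset.univ k, if_pos (Finset.mem_univ k)]
    ring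

theorem bind₁_mul_X {p : Poly} {n : ℕ} (hp : p.IsHomogeneous n) (P : Poly) :
    bind₁ (fun i => P * X i) p = P ^ n * p := by
  conv_lhs => rw [p.as_sum]
  conv_rhs => rw [p.as_sum]
  rw [map_sum, Finset.mul_sum]
  refine Finset.sum_congr rfl fun d hd => ?_
  have hn : ∑ i, d i = n := by
    have := hp (MvPolynomial.mem_support_iff.1 hd)
    rw [weight_one_eq] at this
    rw [← this, Finsupp.degree_eq_sum]
  rw [bind₁_monomial, MvPolynomial.monomial_eq, Finsupp.prod_pow, ← hn]
  have : ∀ g : Fin 3 → Poly, ∏ i ∈ d.support, g i ^ d i = ∏ i, g i ^ d i := fun g =>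
    Finset.prod_subset (Finset.subset_univ _) fun i _ hi => by
      simp [Finsupp.notMem_support_iff.1 hi]
  rw [this, ← Finset.prod_pow_eq_pow_sum]
  simp only [mul_pow, Finset.prod_mul_distrib]
  ring

theorem pullbackForm_ne_zero (φ : BirationalMap) (F : Foliation) :
    ∃ j, pullbackForm φ.coord F.form j ≠ 0 := by
  by_contra! h0
  obtain ⟨ψ, ⟨P, hP, h⟩, -⟩ := φ.birational
  obtain ⟨i₀, hi₀⟩ := F.coprime.exists_ne_zero
  have key : ∀ k, ∑ i, bind₁ (fun i => P * X i) (F.form i) * pderiv k (P * X i) = 0 := by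
    intro k
    have h1 : ∀ i, bind₁ (fun i => P * X i) (F.form i) * pderiv k (P * X i) =
        ∑ j, bind₁ ψ.coord (bind₁ φ.coord (F.form i) * pderiv j (φ.coord i)) *
          pderiv k (ψ.coord j) := by
      intro i
      rw [← h i, pderiv_bind₁, Finset.mul_sum]
      refine Finset.sum_congr rfl fun j _ => ?_
      rw [map_mul, bind₁_bind₁, ← mul_assoc]
      simp_rw [h]
    simp_rw [h1]
    rw [Finset.sum_comm]
    refine Finset.sum_eq_zero fun j _ => ?_
    rw [← Finset.sum_mul, ← map_sum]
    have := h0 j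
    rw [pullbackForm] at this
    rw [this, map_zero, zero_mul]
  have h2 : P ^ (F.degree + 2) * F.form i₀ = 0 := by
    rw [← key i₀]
    have hX : ∀ i, pderiv i₀ (P * X i : Poly) =
        pderiv i₀ P * X i + P * (if i = i₀ then 1 else 0) := by
      intro i
      rw [pderiv_mul, pderiv_X]
      simp [Pi.single_apply]
    simp_rw [hX, bind₁_mul_X (F.homogeneous _)]
    have : ∀ i, P ^ (F.degree + 1) * F.form i *
        (pderiv i₀ P * X i + P * (if i = i₀ then 1 else 0)) =
        P ^ (F.degree + 1) * pderiv i₀ P * (X i * F.form i) +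
        (if i = i₀ then P ^ (F.degree + 2) * F.form i else 0) := by
      intro i
      split_ifs <;> ring
    simp_rw [this]
    rw [Finset.sum_add_distrib, ← Finset.mul_sum, F.radial]
    simp
  exact (mul_ne_zero (pow_ne_zero _ hP) hi₀) h2

theorem exists_isPullback (φ : BirationalMap) (F : Foliation) : ∃ G, IsPullback φ F G := by
  classical
  let _ : StrongNormalizationMonoid Poly :=
    UniqueFactorizationMonoid.strongNormalizationMonoid
  let _ : NormalizedGCDMonoid Poly := UniqueFactorizationMonoid.toNormalizedGCDMonoid Poly
  obtain ⟨j₀, hj₀⟩ := pullbackForm_ne_zero φ F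
  set η := pullbackForm φ.coord F.form with hη
  obtain ⟨g, hg, hg1⟩ := Finset.extract_gcd (s := Finset.univ) η Finset.univ_nonempty
  set P := Finset.univ.gcd η with hPdef
  have hP : P ≠ 0 := fun h => hj₀ (by rw [hg j₀ (Finset.mem_univ _), h, zero_mul])
  have hg0 : g j₀ ≠ 0 := fun h => hj₀ (by rw [hg j₀ (Finset.mem_univ _), h, mul_zero])
  set N := φ.degree * (F.degree + 1) + (φ.degree - 1) with hN
  have hhom : ∀ j, (P * g j).IsHomogeneous N := by
    intro j
    rw [← hg j (Finset.mem_univ _)]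
    refine IsHomogeneous.sum _ _ _ fun i _ => ?_
    exact IsHomogeneous.mul ((F.homogeneous i).aeval _ φ.homogeneous) (φ.homogeneous i).pderiv
  have hdeg : ∀ j, g j ≠ 0 → P.totalDegree + (g j).totalDegree = N := by
    intro j hj
    rw [← totalDegree_mul_of_isDomain hP hj]
    exact (hhom j).totalDegree (mul_ne_zero hP hj)
  have hghom : ∀ j, (g j).IsHomogeneous (g j₀).totalDegree := by
    intro j
    by_cases hj : g j = 0
    · rw [hj]; exact isHomogeneous_zero _ _ _
    · have h1 := isHomogeneous_of_mul hP hj (hhom j)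
      have h2 := hdeg j hj
      have h3 := hdeg j₀ hg0
      have : (g j).totalDegree = (g j₀).totalDegree := by omega
      rwa [this] at h1
  have hcop : NoCommonFactor g := by
    intro p hp
    rw [isUnit_iff_dvd_one, ← hg1]
    exact Finset.dvd_gcd fun i _ => hp i
  have hrad : ∑ j, X j * g j = 0 := by
    have h1 : ∑ j, X j * η j = 0 := by
      have h2 : ∑ j, X j * η j = ∑ i, bind₁ φ.coord (F.form i) * (φ.degree • φ.coord i) := by
        simp_rw [← (φ.homogeneous _).sum_X_mul_pderiv, hη, pullbackForm, Finset.mul_sum]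
        rw [Finset.sum_comm]
        exact Finset.sum_congr rfl fun i _ => Finset.sum_congr rfl fun j _ => by ring
      have h3 : bind₁ φ.coord (∑ i, X i * F.form i) = 0 := by rw [F.radial, map_zero]
      rw [map_sum] at h3
      simp only [map_mul, bind₁_X_right] at h3
      rw [h2]
      calc _ = φ.degree • ∑ i, φ.coord i * bind₁ φ.coord (F.form i) := by
            rw [Finset.smul_sum]
            exact Finset.sum_congr rfl fun i _ => by rw [mul_smul_comm, mul_comm]
        _ = 0 := by rw [h3, smul_zero]
    have h4 : P * ∑ j, X j * g j = 0 := by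
      rw [← h1, Finset.mul_sum]
      exact Finset.sum_congr rfl fun j _ => by rw [hg j (Finset.mem_univ _)]; ring
    exact (mul_eq_zero.1 h4).resolve_left hP
  have hpos : (g j₀).totalDegree ≠ 0 := by
    intro h
    have hC : ∀ j, g j = C (coeff 0 (g j)) := fun j => by
      have := hghom j
      rw [h] at this
      exact totalDegree_eq_zero_iff_eq_C.1 (Nat.le_zero.1 this.totalDegree_le)
    have h5 := congrArg (pderiv j₀) hrad
    rw [map_sum, map_zero, Finset.sum_eq_single j₀] at h5
    · rw [pderiv_mul, hC j₀] at h5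
      simp only [pderiv_X_self, pderiv_C, one_mul, mul_zero, add_zero] at h5
      rw [← hC j₀] at h5
      exact hg0 h5
    · intro j _ hj
      rw [hC j, pderiv_mul, pderiv_X_of_ne hj, pderiv_C]
      simp
    · simp
  refine ⟨⟨(g j₀).totalDegree - 1, g, ?_, hrad, hcop⟩, P, hP, fun j => hg j (Finset.mem_univ _)⟩
  rw [Nat.sub_add_cancel (Nat.one_le_iff_ne_zero.2 hpos)]
  exact hghom

/-- The pull-back of a foliation by a birational map. -/
noncomputable def Foliation.pullback (F : Foliation) (φ : BirationalMap) : Foliation :=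
  (exists_isPullback φ F).choose

theorem Foliation.isPullback_pullback (F : Foliation) (φ : BirationalMap) :
    IsPullback φ F (F.pullback φ) :=
  (exists_isPullback φ F).choose_spec

/-- The pull-back is unique up to a nonzero constant. -/
theorem IsPullback.unique {φ : BirationalMap} {F G H : Foliation} (hG : IsPullback φ F G)
    (hH : IsPullback φ F H) : ∃ c : ℂ, c ≠ 0 ∧ ∀ j, G.form j = C c * H.form j := by
  classical
  let _ : StrongNormalizationMonoid Poly :=
    UniqueFactorizationMonoid.strongNormalizationMonoid
  let _ : NormalizedGCDMonoid Poly := UniqueFactorizationMonoid.toNormalizedGCDMonoid Poly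
  obtain ⟨P, hP, hPG⟩ := hG
  obtain ⟨Q, hQ, hQH⟩ := hH
  have aux : ∀ (K : Foliation) (R : Poly),
      Associated (Finset.univ.gcd fun j => R * K.form j) R := by
    intro K R
    refine (Finset.gcd_mul_left' Finset.univ K.form R).trans ?_
    exact associated_mul_unit_left _ _
      (K.coprime _ fun i => Finset.gcd_dvd (Finset.mem_univ i))
  have hPQ : Associated P Q := by
    refine (aux G P).symm.trans ?_
    have : (fun j => P * G.form j) = fun j => Q * H.form j := by
      funext j; rw [← hPG, ← hQH]
    rw [this]
    exact aux H Q
  obtain ⟨u, hu⟩ := hPQ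
  obtain ⟨c, hc, hcu⟩ := MvPolynomial.isUnit_iff_eq_C_of_isReduced.1 u.isUnit
  refine ⟨c, hc.ne_zero, fun j => mul_left_cancel₀ hP ?_⟩
  rw [← hPG, hQH, ← hu, hcu]
  ring

theorem degree_pullback_eq {φ : BirationalMap} {F G : Foliation} (h : IsPullback φ F G) :
    (F.pullback φ).degree = G.degree := by
  obtain ⟨c, hc, hcG⟩ := (F.isPullback_pullback φ).unique h
  obtain ⟨j, hj⟩ := (F.pullback φ).coprime.exists_ne_zero
  have h1 := (F.pullback φ).homogeneous j
  have h2 : ((F.pullback φ).form j).IsHomogeneous (G.degree + 1) := by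
    rw [hcG]; exact (G.homogeneous j).C_mul c
  exact Nat.succ_injective (h1.inj_right h2 hj)

/-- A foliation is primitive if no birational map lowers its degree. -/
def Foliation.IsPrimitive (F : Foliation) : Prop :=
  ∀ φ : BirationalMap, F.degree ≤ (F.pullback φ).degree

/-- `F` has a rational first integral: a nonconstant rational function `P / Q` of the projective
plane (`P`, `Q` homogeneous of the same degree) such that `d(P / Q) ∧ ω = 0`, `ω` being a 1-form
that defines `F`. -/
def Foliation.HasRationalFirstIntegral (F : Foliation) : Prop :=
  ∃ (m : ℕ) (P Q : Poly), P.IsHomogeneous m ∧ Q.IsHomogeneous m ∧ Q ≠ 0 ∧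
    (∀ c : ℂ, P ≠ C c * Q) ∧
    ∀ i j, (Q * pderiv i P - P * pderiv i Q) * F.form j =
      (Q * pderiv j P - P * pderiv j Q) * F.form i

/-! ### The quadratic involutions `ρ` and `τ` -/

theorem noCommonFactor_of_prime {f : Fin 3 → Poly} (hf : ∃ i, f i ≠ 0)
    (h : ∀ q : Poly, Prime q → ¬ ∀ i, q ∣ f i) : NoCommonFactor f := by
  intro p hp
  by_contra hu
  have hp0 : p ≠ 0 := by
    rintro rfl
    obtain ⟨i, hi⟩ := hf
    exact hi (zero_dvd_iff.1 (hp i))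
  obtain ⟨q, hq, hqp⟩ := WfDvdMonoid.exists_irreducible_factor hu hp0
  exact h q hq.prime fun i => hqp.trans (hp i)

theorem not_prime_dvd_X_X {q : Poly} (hq : Prime q) {i j : Fin 3} (hij : i ≠ j)
    (hi : q ∣ X i) (hj : q ∣ X j) : False := by
  have h1 : Associated q (X i) := hq.associated_of_dvd X_prime hi
  have h2 : (X i : Poly) ∣ X j := h1.symm.dvd.trans hj
  rw [X_dvd_X] at h2
  exact hij h2

/-- `ρ : (x : y : z) ⇢ (xy : z² : yz)`, as a rational map. -/
noncomputable def rhoMap : RationalMap where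
  degree := 2
  coord := ![X 0 * X 1, X 2 ^ 2, X 1 * X 2]
  homogeneous := by
    intro i
    fin_cases i
    · exact (isHomogeneous_X _ _).mul (isHomogeneous_X _ _)
    · exact isHomogeneous_X_pow _ _
    · exact (isHomogeneous_X _ _).mul (isHomogeneous_X _ _)
  coprime := by
    refine noCommonFactor_of_prime ⟨1, pow_ne_zero _ (X_ne_zero _)⟩ fun q hq h => ?_
    have h0 : q ∣ X 0 * X 1 := h 0
    have h1 : q ∣ X 2 ^ 2 := h 1
    have h2 := hq.dvd_of_dvd_pow h1
    rcases hq.dvd_or_dvd h0 with h0 | h0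
    · exact not_prime_dvd_X_X hq (by decide) h0 h2
    · exact not_prime_dvd_X_X hq (by decide) h0 h2

theorem rhoMap_compEqId : rhoMap.CompEqId rhoMap := by
  refine ⟨X 1 * X 2 ^ 2, mul_ne_zero (X_ne_zero _) (pow_ne_zero _ (X_ne_zero _)), fun i => ?_⟩
  fin_cases i <;> simp [rhoMap] <;> ring

/-- `ρ` as a birational map. -/
noncomputable def rho : BirationalMap where
  toRationalMap := rhoMap
  birational := ⟨rhoMap, rhoMap_compEqId, rhoMap_compEqId⟩

/-- `τ : (x : y : z) ⇢ (x² : xy : y² - xz)`, as a rational map. -/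
noncomputable def tauMap : RationalMap where
  degree := 2
  coord := ![X 0 ^ 2, X 0 * X 1, X 1 ^ 2 - X 0 * X 2]
  homogeneous := by
    intro i
    fin_cases i
    · exact isHomogeneous_X_pow _ _
    · exact (isHomogeneous_X _ _).mul (isHomogeneous_X _ _)
    · exact (isHomogeneous_X_pow _ _).sub ((isHomogeneous_X _ _).mul (isHomogeneous_X _ _))
  coprime := by
    refine noCommonFactor_of_prime ⟨0, pow_ne_zero _ (X_ne_zero _)⟩ fun q hq h => ?_
    have h0 : q ∣ X 0 := hq.dvd_of_dvd_pow (h 0)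
    have h2 : q ∣ X 1 ^ 2 - X 0 * X 2 := h 2
    have h1 : q ∣ X 1 ^ 2 := (dvd_sub_left (h0.mul_right _)).1 h2
    exact not_prime_dvd_X_X hq (by decide) h0 (hq.dvd_of_dvd_pow h1)

theorem tauMap_compEqId : tauMap.CompEqId tauMap := by
  refine ⟨X 0 ^ 3, pow_ne_zero _ (X_ne_zero _), fun i => ?_⟩
  fin_cases i <;> simp [tauMap] <;> ring

/-- `τ` as a birational map. -/
noncomputable def tau : BirationalMap where
  toRationalMap := tauMap
  birational := ⟨tauMap, tauMap_compEqId, tauMap_compEqId⟩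

/-! ### The four foliations

Each of them is given first by a 1-form `Ω` in the affine chart `z = 1`, with coordinates
`x` and `y`, then by its homogeneous 1-form; the restriction of the latter to the chart
is `Ω`. -/

/-- The coordinate `x` of the affine chart `z = 1`. -/
noncomputable def affX : MvPolynomial (Fin 2) ℂ := X 0

/-- The coordinate `y` of the affine chart `z = 1`. -/
noncomputable def affY : MvPolynomial (Fin 2) ℂ := X 1

/-- Polynomial 1-forms `a dx + b dy` in the affine chart, written as `![a, b]`. -/
abbrev AffineForm : Type := Fin 2 → MvPolynomial (Fin 2) ℂ

/-- The 1-form `dx` of the affine chart. -/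
noncomputable def dx : AffineForm := ![1, 0]

/-- The 1-form `dy` of the affine chart. -/
noncomputable def dy : AffineForm := ![0, 1]

/-- The restriction to the affine chart `z = 1` of the homogeneous 1-form of a foliation. -/
noncomputable def Foliation.chart (F : Foliation) : AffineForm :=
  fun k => bind₁ ![affX, affY, 1] (F.form k.castSucc)

/-- `Ω₁ = x² dx + y² (x dy - y dx)`. -/
noncomputable def Omega₁ : AffineForm :=
  affX ^ 2 • dx + affY ^ 2 • (affX • dy - affY • dx)

/-- `Ω₂ = x² dx + (x + y²) (x dy - y dx)`. -/
noncomputable def Omega₂ : AffineForm :=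
  affX ^ 2 • dx + (affX + affY ^ 2) • (affX • dy - affY • dx)

/-- `Ω₃ = xy dx + (x² + y²) (x dy - y dx)`. -/
noncomputable def Omega₃ : AffineForm :=
  (affX * affY) • dx + (affX ^ 2 + affY ^ 2) • (affX • dy - affY • dx)

/-- `Ω₄ = (x + y² - x²y) dy + x (x + y²) dx`. -/
noncomputable def Omega₄ : AffineForm :=
  (affX + affY ^ 2 - affX ^ 2 * affY) • dy + (affX * (affX + affY ^ 2)) • dx

/-- The foliation defined by `Ω₁`. -/
noncomputable def foliation₁ : Foliation where
  degree := 2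
  form := ![X 0 ^ 2 * X 2 - X 1 ^ 3, X 0 * X 1 ^ 2, -X 0 ^ 3]
  homogeneous := by
    have h := fun i : Fin 3 => isHomogeneous_X ℂ i
    intro i
    fin_cases i
    · exact (((h 0).pow 2).mul (h 2)).sub ((h 1).pow 3)
    · exact (h 0).mul ((h 1).pow 2)
    · exact ((h 0).pow 3).neg
  radial := by
    simp [Fin.sum_univ_three]; ring
  coprime := by
    refine noCommonFactor_of_prime ⟨2, by simp [X_ne_zero]⟩ fun q hq h => ?_
    have h0 : q ∣ X 0 ^ 2 * X 2 - X 1 ^ 3 := h 0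
    have h2 : q ∣ -X 0 ^ 3 := h 2
    have hx : q ∣ X 0 := hq.dvd_of_dvd_pow ((dvd_neg).1 h2)
    have hy : q ∣ X 1 ^ 3 := by
      have := dvd_sub (hx.mul_right (X 0 * X 2)) h0
      ring_nf at this
      exact this
    exact not_prime_dvd_X_X hq (by decide) hx (hq.dvd_of_dvd_pow hy)

theorem foliation₁_chart : foliation₁.chart = Omega₁ := by
  funext k
  fin_cases k <;> simp [Foliation.chart, foliation₁, Omega₁, dx, dy, affX, affY] <;> ring

/-- The foliation defined by `Ω₂`. -/
noncomputable def foliation₂ : Foliation where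
  degree := 2
  form := ![X 0 ^ 2 * X 2 - X 0 * X 1 * X 2 - X 1 ^ 3, X 0 * (X 0 * X 2 + X 1 ^ 2), -X 0 ^ 3]
  homogeneous := by
    have h := fun i : Fin 3 => isHomogeneous_X ℂ i
    intro i
    fin_cases i
    · exact ((((h 0).pow 2).mul (h 2)).sub (((h 0).mul (h 1)).mul (h 2))).sub ((h 1).pow 3)
    · exact (h 0).mul (((h 0).mul (h 2)).add ((h 1).pow 2))
    · exact ((h 0).pow 3).neg
  radial := by
    simp [Fin.sum_univ_three]; ring
  coprime := by
    refine noCommonFactor_of_prime ⟨2, by simp [X_ne_zero]⟩ fun q hq h => ?_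
    have h0 : q ∣ X 0 ^ 2 * X 2 - X 0 * X 1 * X 2 - X 1 ^ 3 := h 0
    have h2 : q ∣ -X 0 ^ 3 := h 2
    have hx : q ∣ X 0 := hq.dvd_of_dvd_pow ((dvd_neg).1 h2)
    have hy : q ∣ X 1 ^ 3 := by
      have := dvd_sub (hx.mul_right (X 0 * X 2 - X 1 * X 2)) h0
      ring_nf at this
      exact this
    exact not_prime_dvd_X_X hq (by decide) hx (hq.dvd_of_dvd_pow hy)

theorem foliation₂_chart : foliation₂.chart = Omega₂ := by
  funext k
  fin_cases k <;> simp [Foliation.chart, foliation₂, Omega₂, dx, dy, affX, affY] <;> ring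

/-- The foliation defined by `Ω₃`. -/
noncomputable def foliation₃ : Foliation where
  degree := 2
  form := ![X 1 * (X 0 * X 2 - X 0 ^ 2 - X 1 ^ 2), X 0 * (X 0 ^ 2 + X 1 ^ 2), -(X 0 ^ 2 * X 1)]
  homogeneous := by
    have h := fun i : Fin 3 => isHomogeneous_X ℂ i
    intro i
    fin_cases i
    · exact (h 1).mul ((((h 0).mul (h 2)).sub ((h 0).pow 2)).sub ((h 1).pow 2))
    · exact (h 0).mul (((h 0).pow 2).add ((h 1).pow 2))
    · exact (((h 0).pow 2).mul (h 1)).neg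
  radial := by
    simp [Fin.sum_univ_three]; ring
  coprime := by
    refine noCommonFactor_of_prime ⟨2, by simp [X_ne_zero]⟩ fun q hq h => ?_
    have h0 : q ∣ X 1 * (X 0 * X 2 - X 0 ^ 2 - X 1 ^ 2) := h 0
    have h1 : q ∣ X 0 * (X 0 ^ 2 + X 1 ^ 2) := h 1
    have h2 : q ∣ -(X 0 ^ 2 * X 1) := h 2
    rcases hq.dvd_or_dvd ((dvd_neg).1 h2) with hx | hy
    · have hx := hq.dvd_of_dvd_pow hx
      have hy : q ∣ X 1 ^ 3 := by
        have := dvd_sub (hx.mul_right (X 1 * X 2 - X 0 * X 1)) h0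
        ring_nf at this
        exact this
      exact not_prime_dvd_X_X hq (by decide) hx (hq.dvd_of_dvd_pow hy)
    · have hx : q ∣ X 0 ^ 3 := by
        have := dvd_sub h1 (hy.mul_right (X 0 * X 1))
        ring_nf at this
        exact this
      exact not_prime_dvd_X_X hq (by decide) (hq.dvd_of_dvd_pow hx) hy

theorem foliation₃_chart : foliation₃.chart = Omega₃ := by
  funext k
  fin_cases k <;> simp [Foliation.chart, foliation₃, Omega₃, dx, dy, affX, affY] <;> ring

/-- The foliation defined by `Ω₄`. -/
noncomputable def foliation₄ : Foliation where
  degree := 2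
  form := ![X 0 * (X 0 * X 2 + X 1 ^ 2), X 0 * X 2 ^ 2 + X 1 ^ 2 * X 2 - X 0 ^ 2 * X 1,
    -(X 0 ^ 3 + X 0 * X 1 * X 2 + X 1 ^ 3)]
  homogeneous := by
    have h := fun i : Fin 3 => isHomogeneous_X ℂ i
    intro i
    fin_cases i
    · exact (h 0).mul (((h 0).mul (h 2)).add ((h 1).pow 2))
    · exact (((h 0).mul ((h 2).pow 2)).add (((h 1).pow 2).mul (h 2))).sub
        (((h 0).pow 2).mul (h 1))
    · exact ((((h 0).pow 3).add (((h 0).mul (h 1)).mul (h 2))).add ((h 1).pow 3)).neg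
  radial := by
    simp [Fin.sum_univ_three]; ring
  coprime := by
    refine noCommonFactor_of_prime ⟨0, ?_⟩ fun q hq h => ?_
    · refine mul_ne_zero (X_ne_zero _) fun h => ?_
      have := congrArg (eval ![1, 0, 1]) h
      simp at this
    have h0 : q ∣ X 0 * (X 0 * X 2 + X 1 ^ 2) := h 0
    have h1 : q ∣ X 0 * X 2 ^ 2 + X 1 ^ 2 * X 2 - X 0 ^ 2 * X 1 := h 1
    have h2 : q ∣ X 0 ^ 3 + X 0 * X 1 * X 2 + X 1 ^ 3 := (dvd_neg).1 (h 2)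
    have key : ¬ q ∣ X 0 := fun hx => by
      have hy : q ∣ X 1 ^ 3 := by
        have := dvd_sub h2 (hx.mul_right (X 0 ^ 2 + X 1 * X 2))
        ring_nf at this
        exact this
      exact not_prime_dvd_X_X hq (by decide) hx (hq.dvd_of_dvd_pow hy)
    have h3 := (hq.dvd_or_dvd h0).resolve_left key
    have h4 : q ∣ X 0 ^ 2 * X 1 := by
      have := dvd_sub (h3.mul_right (X 2)) h1
      ring_nf at this
      exact this
    have hy := (hq.dvd_or_dvd h4).resolve_left fun hx => key (hq.dvd_of_dvd_pow hx)
    have hx : q ∣ X 0 ^ 3 := by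
      have := dvd_sub h2 (hy.mul_right (X 0 * X 2 + X 1 ^ 2))
      ring_nf at this
      exact this
    exact key (hq.dvd_of_dvd_pow hx)

theorem foliation₄_chart : foliation₄.chart = Omega₄ := by
  funext k
  fin_cases k <;> simp [Foliation.chart, foliation₄, Omega₄, dx, dy, affX, affY]

end CremonaFoliation

namespace CremonaFoliation

open MvPolynomial

/-! ### Composition with linear automorphisms -/

/-! In the chart `x = 1` the first three foliations are elementary equations: `dz = y² dy`, `dz = (z
+ y²) dy` and `y dz = (1 + y²) dy`. Adding to `z` a suitable polynomial in `y` turns them into `dz =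
0`, `dz = z dy` and `dy = y dz`. Such a change is birational, and in the last two cases it is
quadratic, equal to `τ` up to linear maps. This gives the models of degree 0, 1 and 1; the remaining
pull-backs are direct computations.

Degree 0 is impossible for `Ω₂` and `Ω₃`. A foliation of degree 0 is a pencil of lines, so it has a
rational first integral, and a birational map transports it. But the leaves of `dz = z dy` are `z =
c eʸ`; that it has no rational first integral is proved by comparing leading coefficients
(`exists_eq_C_mul_of_expField`).

Primitivity of `Ω₄` excludes models of degree 0 and 1. Such a model has a polynomial integrating
factor `S`, that is, its form divided by `S` is closed (`Foliation.exists_integratingFactor`).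
Transporting it back yields a closed rational multiple of the form `ω` of `Ω₄`. The zeros and poles
of the multiplier are invariant curves (`Foliation.exists_invariant_of_degree_lt`). There are none
(`foliation₄_no_invariant`), so the multiplier is constant and `dω = 0`, which is false.

To see that there is no invariant curve, note that `(0 : 0 : 1)` is a saddle-node with formal weak
separatrix `x = -y² + y⁵ u(y)`. Suppose that a curve of degree `n` is invariant. After the blow-up
`x = t (s + v)`, `y = t`, let `k` be the multiplicity in its equation of the separatrix `s = 0`, and
`e` the order in `t` of what remains at `s = 0` once `sᵏ` is removed. Expanding the cofactor along
the separatrix gives `n = 4k` and `e + n = 12k` (`cofactor_relations`). But `e` is at most the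
multiplicity of the curve at the point, hence at most `n`; so `8k ≤ 4k` and `n = 0`. -/

theorem bind₁_linearCoord (f : Fin 3 → Poly) (A : GL (Fin 3) ℂ) (i : Fin 3) :
    bind₁ f (linearCoord A i) = ∑ j, C ((A : Matrix (Fin 3) (Fin 3) ℂ) i j) * f j := by
  simp [linearCoord]

theorem linearCoord_one (i : Fin 3) : linearCoord 1 i = X i := by
  fin_cases i <;> simp [linearCoord, Matrix.one_apply]

theorem bind₁_linearCoord_linearCoord (A B : GL (Fin 3) ℂ) (i : Fin 3) :
    bind₁ (linearCoord B) (linearCoord A i) = linearCoord (A * B) i := by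
  rw [bind₁_linearCoord]
  simp only [linearCoord, Units.val_mul, Matrix.mul_apply, map_sum, map_mul, Finset.mul_sum,
    Finset.sum_mul]
  rw [Finset.sum_comm]
  simp only [mul_assoc]

theorem bind₁_linearCoord_inv (A : GL (Fin 3) ℂ) (p : Poly) :
    bind₁ (linearCoord A) (bind₁ (linearCoord A⁻¹) p) = p := by
  rw [bind₁_bind₁]
  simp only [bind₁_linearCoord_linearCoord, inv_mul_cancel, linearCoord_one]
  exact aeval_X_left_apply p

theorem isHomogeneous_linearCoord (A : GL (Fin 3) ℂ) (i : Fin 3) :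
    (linearCoord A i).IsHomogeneous 1 :=
  IsHomogeneous.sum _ _ _ fun _ _ => isHomogeneous_C_mul_X _ _

/-- The composition `ℓ ∘ φ` of a rational map and of the automorphism `ℓ` of matrix `A`. -/
noncomputable def RationalMap.linComp (A : GL (Fin 3) ℂ) (φ : RationalMap) : RationalMap where
  degree := φ.degree
  coord i := bind₁ φ.coord (linearCoord A i)
  homogeneous i := by
    rw [bind₁_linearCoord]
    exact IsHomogeneous.sum _ _ _ fun j _ => (φ.homogeneous j).C_mul _
  coprime p hp := φ.coprime p fun i => by
    have h : φ.coord i = bind₁ φ.coord (bind₁ (linearCoord A) (linearCoord A⁻¹ i)) := by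
      rw [bind₁_linearCoord_linearCoord, inv_mul_cancel, linearCoord_one, bind₁_X_right]
    rw [h, bind₁_linearCoord, map_sum]
    exact Finset.dvd_sum fun j _ => by
      rw [map_mul]
      exact (hp j).mul_left _

/-- The composition `φ ∘ ℓ` of a rational map and of the automorphism `ℓ` of matrix `A`. -/
noncomputable def RationalMap.compLin (φ : RationalMap) (A : GL (Fin 3) ℂ) : RationalMap where
  degree := φ.degree
  coord i := bind₁ (linearCoord A) (φ.coord i)
  homogeneous i := by
    have := (φ.homogeneous i).aeval (linearCoord A) (isHomogeneous_linearCoord A)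
    rwa [one_mul] at this
  coprime p hp := by
    have h := φ.coprime (bind₁ (linearCoord A⁻¹) p) fun i => by
      have := map_dvd (bind₁ (linearCoord A⁻¹)) (hp i)
      have h2 := bind₁_linearCoord_inv A⁻¹ (φ.coord i)
      rw [inv_inv] at h2
      rwa [h2] at this
    have := h.map (bind₁ (linearCoord A))
    rwa [bind₁_linearCoord_inv] at this

/-- The composition `ℓ ∘ φ` of a birational map and of the automorphism `ℓ` of matrix `A`. -/
noncomputable def BirationalMap.linComp (A : GL (Fin 3) ℂ) (φ : BirationalMap) :
    BirationalMap where
  toRationalMap := φ.toRationalMap.linComp A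
  birational := by
    obtain ⟨ψ, ⟨P, hP, h1⟩, ⟨Q, hQ, h2⟩⟩ := φ.birational
    -- The inverse of `ℓ ∘ φ` is `φ⁻¹ ∘ ℓ⁻¹`; the first factor gets composed with `ℓ⁻¹`, the second
    -- is unchanged.
    refine ⟨ψ.compLin A⁻¹, ⟨bind₁ (linearCoord A⁻¹) P, fun h => hP ?_, fun i => ?_⟩,
      ⟨Q, hQ, fun i => ?_⟩⟩
    · rw [← bind₁_linearCoord_inv A P, h, map_zero]
    · have : bind₁ ψ.coord (bind₁ φ.coord (linearCoord A i)) = P * linearCoord A i := by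
        rw [bind₁_linearCoord, map_sum, linearCoord, Finset.mul_sum]
        refine Finset.sum_congr rfl fun j _ => ?_
        rw [map_mul, h1, bind₁_C_right]
        ring
      have h3 := congrArg (bind₁ (linearCoord A⁻¹)) this
      rw [bind₁_bind₁, map_mul, bind₁_linearCoord_linearCoord, mul_inv_cancel,
        linearCoord_one] at h3
      exact h3
    · change bind₁ (fun j => bind₁ φ.coord (linearCoord A j))
        (bind₁ (linearCoord A⁻¹) (ψ.coord i)) = _
      rw [← bind₁_bind₁, bind₁_linearCoord_inv, h2]

theorem linComp_mem_orbit (A : GL (Fin 3) ℂ) (φ : BirationalMap) : φ.linComp A ∈ orbit φ :=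
  ⟨A, 1, fun i => by
    have : linearCoord 1 = X := funext linearCoord_one
    simp only [this, bind₁, aeval_X_left_apply]
    rfl⟩

/-! ### Explicit pull-backs -/

theorem pderiv_ofNat (i : Fin 3) (n : ℕ) [n.AtLeastTwo] :
    pderiv i (ofNat(n) : Poly) = 0 :=
  (pderiv i).map_natCast n

/-- The automorphism `(x : y : z) ↦ (y : z : x)`. -/
noncomputable def matrix₁ : GL (Fin 3) ℂ :=
  Matrix.GeneralLinearGroup.mkOfDetNeZero !![0, 1, 0; 0, 0, 1; 1, 0, 0]
    (by simp [Matrix.det_fin_three])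

/-- The automorphism `(x : y : z) ↦ (x : y : -2x - 2y - z)`. -/
noncomputable def matrix₂ : GL (Fin 3) ℂ :=
  Matrix.GeneralLinearGroup.mkOfDetNeZero !![1, 0, 0; 0, 1, 0; -2, -2, -1]
    (by simp [Matrix.det_fin_three])

/-- The automorphism `(x : y : z) ↦ (2x : 2y : z)`. -/
noncomputable def matrix₃ : GL (Fin 3) ℂ :=
  Matrix.GeneralLinearGroup.mkOfDetNeZero !![2, 0, 0; 0, 2, 0; 0, 0, 1]
    (by simp [Matrix.det_fin_three])

/-- The automorphism `(x : y : z) ↦ (2y : 2x : -z)`. -/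
noncomputable def matrix₄ : GL (Fin 3) ℂ :=
  Matrix.GeneralLinearGroup.mkOfDetNeZero !![0, 2, 0; 2, 0, 0; 0, 0, -1]
    (by simp [Matrix.det_fin_three])

/-- The foliation of degree `2` with first integral `y (3 x z - y²) / z³`. -/
noncomputable def pullback₁ : Foliation where
  degree := 2
  form := ![X 1 * X 2 ^ 2, X 2 * (X 0 * X 2 - X 1 ^ 2), X 1 * (X 1 ^ 2 - 2 * (X 0 * X 2))]
  homogeneous := by
    have h := fun i : Fin 3 => isHomogeneous_X ℂ i
    intro i
    fin_cases i
    · exact (h 1).mul ((h 2).pow 2)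
    · exact (h 2).mul (((h 0).mul (h 2)).sub ((h 1).pow 2))
    · exact (h 1).mul (((h 1).pow 2).sub (((h 0).mul (h 2)).C_mul 2))
  radial := by
    simp [Fin.sum_univ_three]; ring
  coprime := by
    refine noCommonFactor_of_prime ⟨0, by simp [X_ne_zero]⟩ fun q hq h => ?_
    have h0 : q ∣ X 1 * X 2 ^ 2 := h 0
    have h1 : q ∣ X 2 * (X 0 * X 2 - X 1 ^ 2) := h 1
    have h2 : q ∣ X 1 * (X 1 ^ 2 - 2 * (X 0 * X 2)) := h 2
    rcases hq.dvd_or_dvd h0 with hy | hz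
    · have hz : q ∣ X 0 * X 2 ^ 2 := by
        convert dvd_add h1 (hy.mul_right (X 1 * X 2)) using 1
        ring
      rcases hq.dvd_or_dvd hz with hx | hz
      · exact not_prime_dvd_X_X hq (by decide) hx hy
      · exact not_prime_dvd_X_X hq (by decide) (hq.dvd_of_dvd_pow hz) hy
    · have hz := hq.dvd_of_dvd_pow hz
      have hy : q ∣ X 1 ^ 3 := by
        convert dvd_add h2 (hz.mul_right (2 * X 0 * X 1)) using 1
        ring
      exact not_prime_dvd_X_X hq (by decide) hz (hq.dvd_of_dvd_pow hy)

/-- The foliation of degree `1` which is a pull-back of the second foliation. -/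
noncomputable def pullback₂ : Foliation where
  degree := 1
  form := ![X 2 * (X 0 - X 1), X 0 * X 2, -X 0 ^ 2]
  homogeneous := by
    have h := fun i : Fin 3 => isHomogeneous_X ℂ i
    intro i
    fin_cases i
    · exact (h 2).mul ((h 0).sub (h 1))
    · exact (h 0).mul (h 2)
    · exact ((h 0).pow 2).neg
  radial := by
    simp [Fin.sum_univ_three]; ring
  coprime := by
    refine noCommonFactor_of_prime ⟨2, by simp [X_ne_zero]⟩ fun q hq h => ?_
    have h0 : q ∣ X 2 * (X 0 - X 1) := h 0
    have h2 : q ∣ -X 0 ^ 2 := h 2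
    have hx := hq.dvd_of_dvd_pow ((dvd_neg).1 h2)
    have hyz : q ∣ X 1 * X 2 := by
      convert dvd_sub (hx.mul_right (X 2)) h0 using 1
      ring
    rcases hq.dvd_or_dvd hyz with hy | hz
    · exact not_prime_dvd_X_X hq (by decide) hx hy
    · exact not_prime_dvd_X_X hq (by decide) hx hz

/-- The foliation of degree `1` which is a pull-back of the third foliation. -/
noncomputable def pullback₃ : Foliation where
  degree := 1
  form := ![-(X 1 * (X 2 + 2 * X 0)), 2 * X 0 ^ 2, X 0 * X 1]
  homogeneous := by
    have h := fun i : Fin 3 => isHomogeneous_X ℂ i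
    intro i
    fin_cases i
    · exact ((h 1).mul ((h 2).add ((h 0).C_mul 2))).neg
    · exact ((h 0).pow 2).C_mul 2
    · exact (h 0).mul (h 1)
  radial := by
    simp [Fin.sum_univ_three]; ring
  coprime := by
    refine noCommonFactor_of_prime ⟨2, by simp [X_ne_zero]⟩ fun q hq h => ?_
    have h0 : q ∣ -(X 1 * (X 2 + 2 * X 0)) := h 0
    have h1 : q ∣ C 2 * X 0 ^ 2 := h 1
    have hx := hq.dvd_of_dvd_pow
      (((isUnit_iff_ne_zero.2 (two_ne_zero (α := ℂ))).map C).dvd_mul_left.1 h1)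
    have hyz : q ∣ X 1 * X 2 := by
      convert dvd_sub ((dvd_neg).1 h0) (hx.mul_right (2 * X 1)) using 1
      ring
    rcases hq.dvd_or_dvd hyz with hy | hz
    · exact not_prime_dvd_X_X hq (by decide) hx hy
    · exact not_prime_dvd_X_X hq (by decide) hx hz

/-- The foliation of degree `3` which is a pull-back of the fourth foliation. -/
noncomputable def pullback₄ : Foliation where
  degree := 3
  form := ![X 0 * X 1 * X 2 ^ 2 + 2 * (X 0 ^ 3 * X 2) - 3 * (X 1 ^ 3 * X 2) -
    8 * (X 0 ^ 2 * X 1 ^ 2), 4 * (X 0 * X 1 * (X 1 * X 2 + 2 * X 0 ^ 2)),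
    -(X 0 * (X 1 ^ 3 + X 0 * X 1 * X 2 + 2 * X 0 ^ 3))]
  homogeneous := by
    have h := fun i : Fin 3 => isHomogeneous_X ℂ i
    intro i
    fin_cases i
    · exact ((((((h 0).mul (h 1)).mul ((h 2).pow 2)).add
        ((((h 0).pow 3).mul (h 2)).C_mul 2)).sub ((((h 1).pow 3).mul (h 2)).C_mul 3))).sub
        ((((h 0).pow 2).mul ((h 1).pow 2)).C_mul 8)
    · exact (((h 0).mul (h 1)).mul (((h 1).mul (h 2)).add (((h 0).pow 2).C_mul 2))).C_mul 4
    · exact ((h 0).mul ((((h 1).pow 3).add (((h 0).mul (h 1)).mul (h 2))).add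
        (((h 0).pow 3).C_mul 2))).neg
  radial := by
    simp [Fin.sum_univ_three]; ring
  coprime := by
    refine noCommonFactor_of_prime ⟨1, ?_⟩ fun q hq h => ?_
    · intro h
      have h : (4 * (X 0 * X 1 * (X 1 * X 2 + 2 * X 0 ^ 2)) : Poly) = 0 := h
      have := congrArg (eval fun _ => 1) h
      norm_num at this
    have h0 : q ∣ X 0 * X 1 * X 2 ^ 2 + 2 * (X 0 ^ 3 * X 2) - 3 * (X 1 ^ 3 * X 2) -
      8 * (X 0 ^ 2 * X 1 ^ 2) := h 0
    have h1 : q ∣ C 4 * (X 0 * X 1 * (X 1 * X 2 + 2 * X 0 ^ 2)) := h 1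
    have h2 : q ∣ X 0 * (X 1 ^ 3 + X 0 * X 1 * X 2 + 2 * X 0 ^ 3) := (dvd_neg).1 (h 2)
    have h1 := ((isUnit_iff_ne_zero.2 (by norm_num : (4 : ℂ) ≠ 0)).map C).dvd_mul_left.1 h1
    have key : ¬ q ∣ X 0 := fun hx => by
      have hyz : q ∣ C 3 * (X 1 ^ 3 * X 2) := by
        convert dvd_sub (hx.mul_right (X 1 * X 2 ^ 2 + 2 * (X 0 ^ 2 * X 2) -
          8 * (X 0 * X 1 ^ 2))) h0 using 1
        change 3 * (X 1 ^ 3 * X 2) = _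
        ring
      have hyz := ((isUnit_iff_ne_zero.2 (three_ne_zero (α := ℂ))).map C).dvd_mul_left.1 hyz
      rcases hq.dvd_or_dvd hyz with hy | hz
      · exact not_prime_dvd_X_X hq (by decide) hx (hq.dvd_of_dvd_pow hy)
      · exact not_prime_dvd_X_X hq (by decide) hx hz
    have h2 := (hq.dvd_or_dvd h2).resolve_left key
    have hy : q ∣ X 1 := by
      rcases hq.dvd_or_dvd h1 with h1 | h1
      · exact (hq.dvd_or_dvd h1).resolve_left key
      · refine hq.dvd_of_dvd_pow (n := 3) ?_
        convert dvd_sub h2 (h1.mul_left (X 0)) using 1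
        ring
    have hx : q ∣ C 2 * X 0 ^ 3 := by
      convert dvd_sub h2 (hy.mul_right (X 1 ^ 2 + X 0 * X 2)) using 1
      change 2 * X 0 ^ 3 = _
      ring
    exact key (hq.dvd_of_dvd_pow
      (((isUnit_iff_ne_zero.2 (two_ne_zero (α := ℂ))).map C).dvd_mul_left.1 hx))

/-- The pencil of lines through `(0 : 1 : 0)`. -/
noncomputable def linePencil : Foliation where
  degree := 0
  form := ![X 2, 0, -X 0]
  homogeneous := by
    intro i
    fin_cases i
    · exact isHomogeneous_X ℂ 2
    · exact isHomogeneous_zero _ _ _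
    · exact (isHomogeneous_X ℂ 0).neg
  radial := by
    simp [Fin.sum_univ_three]; ring
  coprime := by
    refine noCommonFactor_of_prime ⟨0, X_ne_zero _⟩ fun q hq h => ?_
    exact not_prime_dvd_X_X hq (by decide) (h 0) ((dvd_neg).1 (h 2))

theorem isPullback₁ : IsPullback (rho.linComp matrix₁) foliation₁ pullback₁ := by
  have hcoord : (rho.linComp matrix₁).coord = ![X 2 ^ 2, X 1 * X 2, X 0 * X 1] := by
    funext i
    change bind₁ rho.coord (linearCoord matrix₁ i) = _
    rw [bind₁_linearCoord]
    fin_cases i <;> simp [Fin.sum_univ_three, matrix₁, rho, rhoMap,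
      Matrix.GeneralLinearGroup.mkOfDetNeZero]
  -- The pull-back of a form with cubic coefficients by a quadratic map has coefficients of degree
  -- `2 · 3 + 1 = 7`. The common factor `z⁴` leaves degree 3, that is, a foliation of degree 2; the
  -- cases below are counted alike.
  refine ⟨-X 2 ^ 4, by simp [X_ne_zero], fun j => ?_⟩
  rw [hcoord]
  fin_cases j <;> simp [pullbackForm, foliation₁, pullback₁, Fin.sum_univ_three, pderiv_X] <;>
    ring

/-- The equation `dz = (z + y²) dy` has the particular solution `z = -(y² + 2y + 2)`; subtracting it
leaves `dz = z dy`. This is where the entries `-2` of `matrix₂` come from. -/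
theorem isPullback₂ : IsPullback (tau.linComp matrix₂) foliation₂ pullback₂ := by
  have hcoord : (tau.linComp matrix₂).coord = ![X 0 ^ 2, X 0 * X 1,
      X 0 * X 2 - X 1 ^ 2 - 2 * (X 0 * X 1) - 2 * X 0 ^ 2] := by
    funext i
    change bind₁ tau.coord (linearCoord matrix₂ i) = _
    rw [bind₁_linearCoord]
    fin_cases i <;> simp [Fin.sum_univ_three, matrix₂, tau, tauMap,
      Matrix.GeneralLinearGroup.mkOfDetNeZero, map_ofNat]
    ring
  refine ⟨X 0 ^ 5, by simp [X_ne_zero], fun j => ?_⟩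
  rw [hcoord]
  fin_cases j <;> simp [pullbackForm, foliation₂, pullback₂, Fin.sum_univ_three, pderiv_X,
    pderiv_ofNat] <;> ring

/-- In `y dz = (1 + y²) dy` the term `y dy` is absorbed by writing `y² / 2 - z / 2` for `z`, which
is `τ` followed by `matrix₃` in the chart `x = 1`. -/
theorem isPullback₃ : IsPullback (tau.linComp matrix₃) foliation₃ pullback₃ := by
  have hcoord : (tau.linComp matrix₃).coord = ![2 * X 0 ^ 2, 2 * (X 0 * X 1),
      X 1 ^ 2 - X 0 * X 2] := by
    funext i
    change bind₁ tau.coord (linearCoord matrix₃ i) = _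
    rw [bind₁_linearCoord]
    fin_cases i <;> simp [Fin.sum_univ_three, matrix₃, tau, tauMap,
      Matrix.GeneralLinearGroup.mkOfDetNeZero, map_ofNat]
  refine ⟨8 * X 0 ^ 5, by simp [X_ne_zero], fun j => ?_⟩
  rw [hcoord]
  fin_cases j <;> simp [pullbackForm, foliation₃, pullback₃, Fin.sum_univ_three, pderiv_X,
    pderiv_ofNat] <;> ring

theorem isPullback₄ : IsPullback (tau.linComp matrix₄) foliation₄ pullback₄ := by
  have hcoord : (tau.linComp matrix₄).coord = ![2 * (X 0 * X 1), 2 * X 0 ^ 2,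
      X 0 * X 2 - X 1 ^ 2] := by
    funext i
    change bind₁ tau.coord (linearCoord matrix₄ i) = _
    rw [bind₁_linearCoord]
    fin_cases i <;> simp [Fin.sum_univ_three, matrix₄, tau, tauMap,
      Matrix.GeneralLinearGroup.mkOfDetNeZero, map_ofNat]
  refine ⟨4 * X 0 ^ 3, by simp [X_ne_zero], fun j => ?_⟩
  rw [hcoord]
  fin_cases j <;> simp [pullbackForm, foliation₄, pullback₄, Fin.sum_univ_three, pderiv_X,
    pderiv_ofNat] <;> ring

/-! ### The first foliation -/

theorem noCommonFactor_shear {c : ℂ} (hc : c ≠ 0) : NoCommonFactor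
    ![X 0 ^ 3, X 0 ^ 2 * X 1, X 0 ^ 2 * X 2 + C c * X 1 ^ 3] := by
  refine noCommonFactor_of_prime ⟨0, by simp [X_ne_zero]⟩ fun q hq h => ?_
  have h0 : q ∣ X 0 ^ 3 := h 0
  have h2 : q ∣ X 0 ^ 2 * X 2 + C c * X 1 ^ 3 := h 2
  have hx := hq.dvd_of_dvd_pow h0
  have hy : q ∣ C c * X 1 ^ 3 := by
    convert dvd_sub h2 (hx.mul_right (X 0 * X 2)) using 1
    ring
  exact not_prime_dvd_X_X hq (by decide) hx (hq.dvd_of_dvd_pow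
    (((isUnit_iff_ne_zero.2 hc).map C).dvd_mul_left.1 hy))

/-- The map `(x : y : z) ⇢ (x³ : x² y : x² z + c y³)`. -/
noncomputable def shearMap (c : ℂ) (hc : c ≠ 0) : RationalMap where
  degree := 3
  coord := ![X 0 ^ 3, X 0 ^ 2 * X 1, X 0 ^ 2 * X 2 + C c * X 1 ^ 3]
  homogeneous := by
    have h := fun i : Fin 3 => isHomogeneous_X ℂ i
    intro i
    fin_cases i
    · exact (h 0).pow 3
    · exact ((h 0).pow 2).mul (h 1)
    · exact (((h 0).pow 2).mul (h 2)).add (((h 1).pow 3).C_mul c)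
  coprime := noCommonFactor_shear hc

theorem shearMap_compEqId (c : ℂ) (hc : c ≠ 0) :
    (shearMap c hc).CompEqId (shearMap (-c) (neg_ne_zero.2 hc)) := by
  refine ⟨X 0 ^ 8, pow_ne_zero _ (X_ne_zero _), fun i => ?_⟩
  fin_cases i <;> simp [shearMap] <;> ring

/-- The birational map `(x : y : z) ⇢ (x³ : x² y : x² z + y³ / 3)`. -/
noncomputable def shear : BirationalMap where
  toRationalMap := shearMap (1 / 3) (by norm_num)
  birational := ⟨shearMap (-(1 / 3)) (by norm_num), shearMap_compEqId _ _, by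
    convert shearMap_compEqId (-(1 / 3)) (by norm_num) using 2
    norm_num⟩

/-- Integrating `dz = y² dy` gives `z - y³ / 3` constant, and the shear sends `z` to `z + y³ / 3`.
-/
theorem isPullback_shear : IsPullback shear foliation₁ linePencil := by
  refine ⟨X 0 ^ 10, pow_ne_zero _ (X_ne_zero _), fun j => ?_⟩
  have h3 : (C (1 / 3) * 3 : Poly) = 1 := by
    rw [← map_ofNat C 3, ← C_mul]
    norm_num
  fin_cases j <;> simp [pullbackForm, foliation₁, linePencil, shear, shearMap,
    Fin.sum_univ_three, pderiv_X, -one_div]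
  · linear_combination X 0 ^ 8 * X 1 ^ 3 * h3
  · linear_combination -X 0 ^ 9 * X 1 ^ 2 * h3
  · ring

theorem foliation₁_hasRationalFirstIntegral : foliation₁.HasRationalFirstIntegral := by
  have h := fun i : Fin 3 => isHomogeneous_X ℂ i
  refine ⟨3, 3 * (X 0 ^ 2 * X 2) - X 1 ^ 3, X 0 ^ 3,
    ((((h 0).pow 2).mul (h 2)).C_mul 3).sub ((h 1).pow 3), (h 0).pow 3,
    pow_ne_zero _ (X_ne_zero _), fun c hc => ?_, fun i j => ?_⟩
  · have := congrArg (eval ![0, 1, 0]) hc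
    norm_num at this
  · fin_cases i <;> fin_cases j <;>
      simp [foliation₁, pderiv_X, pderiv_ofNat] <;> ring

end CremonaFoliation

namespace CremonaFoliation

open MvPolynomial

/-! ### Pull-backs of forms and inverse maps -/

theorem pullbackForm_mul (f ω : Fin 3 → Poly) (P : Poly) (j : Fin 3) :
    pullbackForm f (fun i => P * ω i) j = bind₁ f P * pullbackForm f ω j := by
  simp only [pullbackForm, map_mul, Finset.mul_sum, mul_assoc]

theorem pullbackForm_comp (f g ω : Fin 3 → Poly) (k : Fin 3) :
    pullbackForm (fun i => bind₁ g (f i)) ω k = pullbackForm g (pullbackForm f ω) k := by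
  simp only [pullbackForm, map_sum, map_mul, pderiv_bind₁, Finset.mul_sum, Finset.sum_mul,
    bind₁_bind₁]
  rw [Finset.sum_comm]
  exact Finset.sum_congr rfl fun i _ => Finset.sum_congr rfl fun j _ => by ring

/-- The terms containing `dP` are multiples of the contraction of the form with the radial field,
which vanishes. -/
theorem Foliation.pullbackForm_mul_X (F : Foliation) (P : Poly) (k : Fin 3) :
    pullbackForm (fun i => P * X i) F.form k = P ^ (F.degree + 2) * F.form k := by
  have h : ∀ i, bind₁ (fun i => P * X i) (F.form i) * pderiv k (P * X i) =
      P ^ (F.degree + 1) * pderiv k P * (X i * F.form i) +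
        (if i = k then P ^ (F.degree + 2) * F.form i else 0) := by
    intro i
    rw [bind₁_mul_X (F.homogeneous i), pderiv_mul, pderiv_X]
    by_cases h : i = k
    · subst h; simp; ring
    · simp [h]; ring
  simp only [pullbackForm, h]
  rw [Finset.sum_add_distrib, ← Finset.mul_sum, F.radial]
  simp

theorem IsHomogeneous.of_mul_left {p q : Poly} {n : ℕ} (hp : p ≠ 0) (hq : q ≠ 0)
    (h : (p * q).IsHomogeneous n) : p.IsHomogeneous p.totalDegree :=
  isHomogeneous_of_mul hq hp (by rwa [mul_comm])

theorem isHomogeneous_of_mul_add {p q : Poly} {m n : ℕ} (hp : p ≠ 0) (hpm : p.IsHomogeneous m)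
    (h : (p * q).IsHomogeneous (m + n)) : q.IsHomogeneous n := by
  rcases eq_or_ne q 0 with rfl | hq
  · exact isHomogeneous_zero _ _ _
  · have h1 := isHomogeneous_of_mul hp hq h
    have h2 := (hpm.mul h1).inj_right h (mul_ne_zero hp hq)
    rwa [Nat.add_left_cancel h2] at h1

/-- The substitution in homogeneous polynomials of a map with a left inverse is injective. -/
theorem RationalMap.CompEqId.bind₁_ne_zero {φ ψ : RationalMap} (h : φ.CompEqId ψ) {p : Poly}
    {n : ℕ} (hp : p.IsHomogeneous n) (h0 : p ≠ 0) : bind₁ φ.coord p ≠ 0 := by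
  obtain ⟨P, hP, h⟩ := h
  intro hz
  have h1 := congrArg (bind₁ ψ.coord) hz
  rw [bind₁_bind₁, map_zero] at h1
  simp only [h, bind₁_mul_X hp] at h1
  exact mul_ne_zero (pow_ne_zero _ hP) h0 h1

/-- The inverse of a birational map pulls back the pull-back of a foliation to this foliation. -/
theorem IsPullback.exists_inverse {φ : BirationalMap} {F G : Foliation} (h : IsPullback φ F G) :
    ∃ (ψ : RationalMap) (A B : Poly) (a b : ℕ), A ≠ 0 ∧ B ≠ 0 ∧ A.IsHomogeneous a ∧
      B.IsHomogeneous b ∧ (∀ j, A * F.form j = B * pullbackForm ψ.coord G.form j) ∧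
      ∀ (p : Poly) (n : ℕ), p.IsHomogeneous n → p ≠ 0 → bind₁ ψ.coord p ≠ 0 := by
  obtain ⟨ψ, ⟨Q, hQ, h1⟩, h2⟩ := φ.birational
  obtain ⟨P, hP, hPG⟩ := h
  obtain ⟨j₀, hj₀⟩ := G.coprime.exists_ne_zero
  have hPhom : P.IsHomogeneous P.totalDegree := by
    refine IsHomogeneous.of_mul_left hP hj₀
      (n := φ.degree * (F.degree + 1) + (φ.degree - 1)) ?_
    rw [← hPG]
    exact IsHomogeneous.sum _ _ _ fun i _ =>
      IsHomogeneous.mul ((F.homogeneous i).aeval _ φ.homogeneous) (φ.homogeneous i).pderiv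
  have hQhom : Q.IsHomogeneous Q.totalDegree := by
    refine IsHomogeneous.of_mul_left hQ (X_ne_zero 0) (n := ψ.degree * φ.degree) ?_
    rw [← h1]
    exact (φ.homogeneous 0).aeval _ ψ.homogeneous
  -- Pull back `φ^* F = P G` by `ψ`: as `φ ∘ ψ` is `Q` times the identity, the left side is `Q ^
  -- (F.degree + 2)` times the form of `F`.
  refine ⟨ψ, Q ^ (F.degree + 2), bind₁ ψ.coord P, _, _, pow_ne_zero _ hQ,
    h2.bind₁_ne_zero hPhom hP, hQhom.pow _, hPhom.aeval _ ψ.homogeneous, fun j => ?_,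
    fun p n => h2.bind₁_ne_zero⟩
  rw [← F.pullbackForm_mul_X, ← pullbackForm_mul]
  simp_rw [← hPG, ← h1]
  exact pullbackForm_comp _ _ _ _

/-! ### Foliations of degree zero -/

theorem isHomogeneous_one_eq {p : Poly} (hp : p.IsHomogeneous 1) :
    ∃ a : Fin 3 → ℂ, (∀ i, pderiv i p = C (a i)) ∧ p = ∑ i, C (a i) * X i := by
  have h : ∀ i, pderiv i p = C (coeff 0 (pderiv i p)) := fun i =>
    totalDegree_eq_zero_iff_eq_C.1 (Nat.le_zero.1 (hp.pderiv (i := i)).totalDegree_le)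
  refine ⟨fun i => coeff 0 (pderiv i p), h, ?_⟩
  have h2 := hp.sum_X_mul_pderiv
  rw [one_smul] at h2
  exact h2.symm.trans (Finset.sum_congr rfl fun i _ => by rw [mul_comm, ← h i])

/-- Skew-symmetry is the second derivative of the radial relation. -/
theorem Foliation.exists_skew (G : Foliation) (hG : G.degree = 0) :
    ∃ m : Fin 3 → Fin 3 → ℂ, (∀ i j, m i j = -m j i) ∧ (∀ i j, pderiv j (G.form i) = C (m i j)) ∧
      ∀ i, G.form i = ∑ j, C (m i j) * X j := by
  have h : ∀ i, (G.form i).IsHomogeneous 1 := fun i => by simpa [hG] using G.homogeneous i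
  choose m hm hm' using fun i => isHomogeneous_one_eq (h i)
  refine ⟨m, fun i j => ?_, hm, hm'⟩
  have h1 := congrArg (pderiv j) (congrArg (pderiv i) G.radial)
  simp only [Fin.sum_univ_three, map_add, pderiv_mul, hm, pderiv_C, map_zero, pderiv_X] at h1
  have h2 : (C (m i j + m j i) : Poly) = 0 := by
    rw [← h1]
    fin_cases i <;> fin_cases j <;> simp <;> exact add_comm _ _
  rw [← C_0, C_inj] at h2
  linear_combination h2

/-- A skew form in three variables is a cross product with a fixed vector, so the leaves are the
lines through a point and the quotient of two independent coefficients is constant on them. -/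
theorem Foliation.firstIntegral_of_degree_eq_zero (G : Foliation) (hG : G.degree = 0) :
    ∃ (i j : Fin 3) (c : ℂ), c ≠ 0 ∧ ∀ k, G.form i * pderiv k (G.form j) -
      G.form j * pderiv k (G.form i) = C c * G.form k := by
  obtain ⟨m, hs, hd, hf⟩ := G.exists_skew hG
  obtain ⟨i, hi⟩ := G.coprime.exists_ne_zero
  obtain ⟨j, hj⟩ : ∃ j, m i j ≠ 0 := by
    by_contra! h
    exact hi (by rw [hf]; simp [h])
  refine ⟨i, j, -m i j, neg_ne_zero.2 hj, fun k => ?_⟩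
  have h0 : ∀ i, m i i = 0 := fun i => self_eq_neg.1 (hs i i)
  rw [hd, hd, hf, hf, hf]
  simp only [Fin.sum_univ_three]
  clear hj hi
  fin_cases i <;> fin_cases j <;> fin_cases k <;>
    simp only [Fin.zero_eta, Fin.mk_one, Fin.reduceFinMk, h0, hs 1 0, hs 2 0, hs 2 1,
      C_0, C_neg] <;> ring

/-- With `f` a nonzero coefficient and `g` another one such that `g / f` is a first integral, the
form is a constant times `f² d(g / f)`; so `f²` works. -/
theorem Foliation.exists_integratingFactor_of_degree_eq_zero (G : Foliation) (hG : G.degree = 0) :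
    ∃ (S : Poly) (n : ℕ), S ≠ 0 ∧ S.IsHomogeneous n ∧ ∀ j k,
      S * (pderiv k (G.form j) - pderiv j (G.form k)) =
        pderiv k S * G.form j - pderiv j S * G.form k := by
  obtain ⟨m, hs, hd, hf⟩ := G.exists_skew hG
  obtain ⟨i, hi⟩ := G.coprime.exists_ne_zero
  refine ⟨G.form i ^ 2, _, pow_ne_zero _ hi, (G.homogeneous i).pow 2, fun j k => ?_⟩
  have h0 : ∀ i, m i i = 0 := fun i => self_eq_neg.1 (hs i i)
  clear hi
  have key : G.form i * (C (m j k) - C (m k j)) =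
      2 * (C (m i k) * G.form j - C (m i j) * G.form k) := by
    rw [hf, hf, hf]
    simp only [Fin.sum_univ_three]
    fin_cases i <;> fin_cases j <;> fin_cases k <;>
      simp only [Fin.zero_eta, Fin.mk_one, Fin.reduceFinMk, h0, hs 1 0, hs 2 0, hs 2 1,
      C_0, C_neg] <;> ring
  rw [pderiv_pow, pderiv_pow, hd, hd, hd, hd]
  push_cast
  linear_combination G.form i * key

end CremonaFoliation

namespace CremonaFoliation

open MvPolynomial

/-! ### Derivations -/

/-- The derivation of `R[X]` which applies a derivation of `R` to the coefficients. -/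
noncomputable def coeffDerivation {R : Type*} [CommRing R] [Algebra ℂ R] (d : Derivation ℂ R R) :
    Derivation ℂ (Polynomial R) (Polynomial R) :=
  (PolynomialModule.equivPolynomialSelf (R := R)).toLinearMap.compDer d.mapCoeffs

theorem coeff_coeffDerivation {R : Type*} [CommRing R] [Algebra ℂ R] (d : Derivation ℂ R R)
    (p : Polynomial R) (i : ℕ) : (coeffDerivation d p).coeff i = d (p.coeff i) := rfl

theorem coeffDerivation_C {R : Type*} [CommRing R] [Algebra ℂ R] (d : Derivation ℂ R R) (r : R) :
    coeffDerivation d (Polynomial.C r) = Polynomial.C (d r) := by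
  ext i
  rw [coeff_coeffDerivation, Polynomial.coeff_C, Polynomial.coeff_C]
  split_ifs <;> simp

theorem coeffDerivation_X {R : Type*} [CommRing R] [Algebra ℂ R] (d : Derivation ℂ R R) :
    coeffDerivation d (Polynomial.X : Polynomial R) = 0 := by
  ext i
  rw [coeff_coeffDerivation, Polynomial.coeff_X]
  split_ifs <;> simp

theorem derivation_aeval {S : Type*} [CommRing S] [Algebra ℂ S] (E : Derivation ℂ S S)
    (f : Fin 3 → S) (p : Poly) :
    E (aeval f p) = ∑ i, aeval f (pderiv i p) * E (f i) := by
  induction p using MvPolynomial.induction_on with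
  | C a => simp
  | add p q hp hq => simp [hp, hq, add_mul, Finset.sum_add_distrib]
  | mul_X p k hp =>
    rw [map_mul, aeval_X, E.leibniz, hp]
    have h1 : ∀ i, aeval f (pderiv i (p * X k)) * E (f i) =
        f k * (aeval f (pderiv i p) * E (f i)) + if i = k then aeval f p * E (f i) else 0 := by
      intro i
      rw [pderiv_mul, pderiv_X]
      by_cases hik : i = k
      · subst hik; simp; ring
      · simp [hik, Ne.symm hik]; ring
    simp_rw [h1]
    rw [Finset.sum_add_distrib, ← Finset.mul_sum]
    simp [add_comm]

/-! ### The linear differential equation `dz = z dy` has no rational first integral -/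

/-- Top coefficients force `a` and `b` to have the same degree. If the combination `r` that cancels
the leading term were nonzero, it would satisfy the same equation and so have this degree too. -/
theorem exists_eq_C_mul_of_derivative {a b : Polynomial ℂ} (hb : b ≠ 0)
    (h : Polynomial.derivative a * b = a * Polynomial.derivative b) :
    ∃ c, a = Polynomial.C c * b := by
  have key : ∀ a : Polynomial ℂ, a ≠ 0 →
      Polynomial.derivative a * b = a * Polynomial.derivative b → a.natDegree = b.natDegree := by
    intro a ha h
    have hd : ∀ p : Polynomial ℂ, (Polynomial.X * Polynomial.derivative p).natDegree ≤ p.natDegree ∧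
        (Polynomial.X * Polynomial.derivative p).coeff p.natDegree =
          p.natDegree * p.leadingCoeff := by
      intro p
      have hc : ∀ i, (Polynomial.X * Polynomial.derivative p).coeff i = i * p.coeff i := by
        intro i
        cases i with
        | zero => simp
        | succ i => rw [Polynomial.coeff_X_mul, Polynomial.coeff_derivative]; push_cast; ring
      refine ⟨Polynomial.natDegree_le_iff_coeff_eq_zero.2 fun i hi => ?_, hc _⟩
      rw [hc, Polynomial.coeff_eq_zero_of_natDegree_lt hi, mul_zero]
    -- The factor `X` makes the derivation preserve degrees: it multiplies the top coefficient by
    -- the degree.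
    have h1 : (Polynomial.X * Polynomial.derivative a) * b =
        a * (Polynomial.X * Polynomial.derivative b) := by linear_combination Polynomial.X * h
    have h2 := congrArg (fun p => p.coeff (a.natDegree + b.natDegree)) h1
    simp only [Polynomial.coeff_mul_add_eq_of_natDegree_le (hd a).1 le_rfl,
      Polynomial.coeff_mul_add_eq_of_natDegree_le le_rfl (hd b).1, (hd a).2, (hd b).2,
      Polynomial.coeff_natDegree] at h2
    have h3 : ((a.natDegree : ℂ) - b.natDegree) * (a.leadingCoeff * b.leadingCoeff) = 0 := by
      linear_combination h2
    have h4 := (mul_eq_zero.1 h3).resolve_right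
      (mul_ne_zero (Polynomial.leadingCoeff_ne_zero.2 ha) (Polynomial.leadingCoeff_ne_zero.2 hb))
    exact_mod_cast sub_eq_zero.1 h4
  by_cases ha : a = 0
  · exact ⟨0, by simp [ha]⟩
  have hab := key a ha h
  refine ⟨a.leadingCoeff / b.leadingCoeff, ?_⟩
  by_contra hne
  set r := a - Polynomial.C (a.leadingCoeff / b.leadingCoeff) * b with hr
  have hr0 : r ≠ 0 := sub_ne_zero.2 hne
  have hrd := key r hr0 (by simp [hr]; linear_combination h)
  refine hr0 (Polynomial.leadingCoeff_eq_zero.1 ?_)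
  rw [Polynomial.leadingCoeff, hrd, hr, Polynomial.coeff_sub, Polynomial.coeff_C_mul, ← hab,
    Polynomial.coeff_natDegree, hab, Polynomial.coeff_natDegree,
    div_mul_cancel₀ _ (Polynomial.leadingCoeff_ne_zero.2 hb), sub_self]

/-- The vector field `∂/∂y + z ∂/∂z` on `ℂ[y][z]`. -/
noncomputable def expField :
    Derivation ℂ (Polynomial (Polynomial ℂ)) (Polynomial (Polynomial ℂ)) :=
  coeffDerivation Polynomial.derivative' + (Polynomial.X : Polynomial (Polynomial ℂ)) •
    (Polynomial.derivative' (R := Polynomial ℂ)).restrictScalars ℂ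

theorem expField_C (p : Polynomial ℂ) :
    expField (Polynomial.C p) = Polynomial.C (Polynomial.derivative p) := by
  simp [expField, coeffDerivation_C, Polynomial.derivative']

theorem expField_X : expField Polynomial.X = Polynomial.X := by
  simp [expField, coeffDerivation_X, Polynomial.derivative']

theorem coeff_expField (p : Polynomial (Polynomial ℂ)) (i : ℕ) :
    (expField p).coeff i = Polynomial.derivative (p.coeff i) + i * p.coeff i := by
  have h : expField p = coeffDerivation Polynomial.derivative' p +
      Polynomial.X * Polynomial.derivative p := rfl
  rw [h, Polynomial.coeff_add, coeff_coeffDerivation]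
  congr 1
  cases i with
  | zero => simp
  | succ i => rw [Polynomial.coeff_X_mul, Polynomial.coeff_derivative]; push_cast; ring

/-- The field acts on the coefficient of `zⁱ` by `p ↦ p' + i p`. The leading coefficients `a`, `b`
in `z` then satisfy `(deg n - deg d) a b = a b' - a' b`. The right side has smaller degree in `y`,
so the degrees in `z` agree and `a / b` is constant; subtracting the corresponding multiple of `d`
concludes as before. -/
theorem exists_eq_C_mul_of_expField {n d : Polynomial (Polynomial ℂ)} (hd : d ≠ 0)
    (h : expField n * d = n * expField d) :
    ∃ c, n = Polynomial.C (Polynomial.C c) * d := by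
  have hdeg : ∀ p, (expField p).natDegree ≤ p.natDegree := fun p =>
    Polynomial.natDegree_le_iff_coeff_eq_zero.2 fun i hi => by
      rw [coeff_expField, Polynomial.coeff_eq_zero_of_natDegree_lt hi]; simp
  have key : ∀ n, n ≠ 0 → expField n * d = n * expField d → n.natDegree = d.natDegree ∧
      ∃ c, n.leadingCoeff = Polynomial.C c * d.leadingCoeff := by
    intro n hn h
    have h2 := congrArg (fun p => p.coeff (n.natDegree + d.natDegree)) h
    simp only [Polynomial.coeff_mul_add_eq_of_natDegree_le (hdeg n) le_rfl,
      Polynomial.coeff_mul_add_eq_of_natDegree_le le_rfl (hdeg d), coeff_expField,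
      Polynomial.coeff_natDegree] at h2
    have hn0 := Polynomial.leadingCoeff_ne_zero.2 hn
    have hd0 := Polynomial.leadingCoeff_ne_zero.2 hd
    generalize n.leadingCoeff = a at *
    generalize d.leadingCoeff = b at *
    have h3 : Polynomial.C ((n.natDegree : ℂ) - d.natDegree) * (a * b) =
        a * Polynomial.derivative b - Polynomial.derivative a * b := by
      simp only [map_sub, map_natCast]
      linear_combination h2
    have h4 := congrArg (fun p => p.coeff (a.natDegree + b.natDegree)) h3
    have hder : ∀ p : Polynomial ℂ, (Polynomial.derivative p).coeff p.natDegree = 0 := fun p => by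
      rw [Polynomial.coeff_derivative, Polynomial.coeff_eq_zero_of_natDegree_lt (Nat.lt_succ_self _),
        zero_mul]
    have hder' : ∀ p : Polynomial ℂ, (Polynomial.derivative p).natDegree ≤ p.natDegree := fun p =>
      (Polynomial.natDegree_derivative_le p).trans (Nat.sub_le _ _)
    simp only [Polynomial.coeff_C_mul, Polynomial.coeff_sub,
      Polynomial.coeff_mul_add_eq_of_natDegree_le le_rfl (le_refl b.natDegree),
      Polynomial.coeff_mul_add_eq_of_natDegree_le le_rfl (hder' b),
      Polynomial.coeff_mul_add_eq_of_natDegree_le (hder' a) le_rfl, hder,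
      Polynomial.coeff_natDegree, mul_zero, zero_mul, sub_zero] at h4
    have h5 := (mul_eq_zero.1 h4).resolve_right
      (mul_ne_zero (Polynomial.leadingCoeff_ne_zero.2 hn0) (Polynomial.leadingCoeff_ne_zero.2 hd0))
    refine ⟨by exact_mod_cast sub_eq_zero.1 h5, exists_eq_C_mul_of_derivative hd0 ?_⟩
    rw [h5, map_zero, zero_mul] at h3
    linear_combination h3
  by_cases hn : n = 0
  · exact ⟨0, by simp [hn]⟩
  obtain ⟨hnd, c, hc⟩ := key n hn h
  refine ⟨c, ?_⟩
  by_contra hne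
  set r := n - Polynomial.C (Polynomial.C c) * d with hr
  have hr0 : r ≠ 0 := sub_ne_zero.2 hne
  have hrd := (key r hr0 (by
    simp only [hr, map_sub, Derivation.leibniz, expField_C, Polynomial.derivative_C, map_zero,
      smul_eq_mul]
    linear_combination h)).1
  refine hr0 (Polynomial.leadingCoeff_eq_zero.1 ?_)
  rw [Polynomial.leadingCoeff, hrd, hr, Polynomial.coeff_sub, Polynomial.coeff_C_mul,
    Polynomial.coeff_natDegree, ← hnd, Polynomial.coeff_natDegree, hc, sub_self]

/-! ### Exclusion of birational models of degree zero. -/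

theorem eq_zero_of_eval_chart_eq_zero {F : Poly} {n : ℕ} (hF : F.IsHomogeneous n)
    (h : ∀ b c, eval ![1, b, c] F = 0) : F = 0 := by
  -- The factor `X 0` takes care of the line `x = 0`; elsewhere homogeneity brings a point into the
  -- chart.
  have h1 : X 0 * F = 0 := by
    refine MvPolynomial.funext fun v => ?_
    rw [map_mul, eval_X, map_zero]
    by_cases hv : v 0 = 0
    · rw [hv, zero_mul]
    · have h2 := congrArg (eval v) (bind₁_mul_X (P := C (v 0)⁻¹) hF)
      have h3 : eval v (bind₁ (fun i => C (v 0)⁻¹ * X i) F) = 0 := by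
        rw [← h (v 1 / v 0) (v 2 / v 0), eval, eval₂Hom_bind₁]
        congr 1
        congr 1
        funext i
        fin_cases i <;> simp [hv, div_eq_inv_mul]
      rw [h3, map_mul, map_pow, eval_C] at h2
      rw [(mul_eq_zero.1 h2.symm).resolve_left (pow_ne_zero _ (inv_ne_zero hv)), mul_zero]
  exact (mul_eq_zero.1 h1).resolve_left (X_ne_zero 0)

/-- A foliation which becomes `dz = z dy` after an invertible substitution in the chart `x = 1` has
no birational model of degree zero. -/
theorem degree_pullback_ne_zero_of_expField (F : Foliation)
    (e : Fin 3 → Polynomial (Polynomial ℂ)) (he0 : e 0 = 1)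
    (he1 : expField (e 1) = -aeval e (F.form 2)) (he2 : expField (e 2) = aeval e (F.form 1))
    (he : ∀ b c : ℂ, ∃ b' c' : ℂ, (e 1).evalEval b' c' = b ∧ (e 2).evalEval b' c' = c)
    (φ : BirationalMap) : (F.pullback φ).degree ≠ 0 := by
  intro hG
  obtain ⟨ψ, A, B, a, b, hA, hB, -, -, hAB, hψ⟩ := (F.isPullback_pullback φ).exists_inverse
  set G := F.pullback φ
  obtain ⟨i, j, c, hc, hij⟩ := G.firstIntegral_of_degree_eq_zero hG
  set N := bind₁ ψ.coord (G.form i) with hN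
  set D := bind₁ ψ.coord (G.form j) with hD
  have hhom : ∀ i, (bind₁ ψ.coord (G.form i)).IsHomogeneous (ψ.degree * (G.degree + 1)) := fun i =>
    (G.homogeneous i).aeval _ ψ.homogeneous
  -- `N / D` is the first integral of `G` carried back to `F`: its differential is proportional to
  -- the form of `F`.
  have hND : ∀ k, B * (N * pderiv k D - D * pderiv k N) = C c * A * F.form k := by
    intro k
    have h1 : N * pderiv k D - D * pderiv k N = C c * pullbackForm ψ.coord G.form k := by
      have h2 : pullbackForm ψ.coord (fun k => G.form i * pderiv k (G.form j) -
          G.form j * pderiv k (G.form i)) k = pullbackForm ψ.coord (fun k => C c * G.form k) k := by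
        simp_rw [hij]
      rw [pullbackForm_mul, bind₁_C_right] at h2
      rw [← h2, hN, hD, pderiv_bind₁, pderiv_bind₁]
      simp only [pullbackForm, map_sub, map_mul, Finset.mul_sum, ← Finset.sum_sub_distrib]
      exact Finset.sum_congr rfl fun i _ => by ring
    rw [h1]
    linear_combination -C c * hAB k
  have hcontra : ∀ k, N * pderiv k D - D * pderiv k N = 0 → F.form k = 0 := fun k hk => by
    have := hND k
    rw [hk, mul_zero] at this
    exact (mul_eq_zero.1 this.symm).resolve_left
      (mul_ne_zero (by rwa [Ne, C_eq_zero]) hA)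
  obtain ⟨k₀, hk₀⟩ := F.coprime.exists_ne_zero
  have hpar : F.form 2 * (N * pderiv 1 D - D * pderiv 1 N) =
      F.form 1 * (N * pderiv 2 D - D * pderiv 2 N) := by
    refine mul_left_cancel₀ hB ?_
    linear_combination F.form 2 * hND 1 - F.form 1 * hND 2
  -- In the chart the field tangent to `B dy + C dz` is `-C ∂/∂y + B ∂/∂z`; the substitution turns
  -- it into `expField`.
  have hE : ∀ p, expField (aeval e p) =
      aeval e (F.form 1 * pderiv 2 p - F.form 2 * pderiv 1 p) := by
    intro p
    rw [derivation_aeval, Fin.sum_univ_three, he0, he1, he2, map_sub, map_mul, map_mul]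
    simp
    ring
  -- Since the substitution is onto the chart, it kills no nonzero homogeneous polynomial.
  have hinj : ∀ p : Poly, ∀ n, p.IsHomogeneous n → aeval e p = 0 → p = 0 := by
    intro p n hp h0
    refine eq_zero_of_eval_chart_eq_zero hp fun b c => ?_
    obtain ⟨b', c', hb, hc⟩ := he b c
    have h1 := congrArg (Polynomial.evalEvalRingHom b' c') h0
    rw [map_aeval, map_zero] at h1
    rw [← h1, eval]
    have h2 : ((Polynomial.evalEvalRingHom b' c').comp
        (algebraMap ℂ (Polynomial (Polynomial ℂ)))) = RingHom.id ℂ := by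
      ext; simp
    rw [h2]
    congr 2
    funext i
    fin_cases i
    · simp [he0]
    · simp [hb]
    · simp [hc]
  by_cases hD0 : D = 0
  · exact hk₀ (hcontra k₀ (by simp [hD0]))
  have hd : aeval e D ≠ 0 := fun h => hD0 (hinj D _ (hhom j) h)
  obtain ⟨c', hc'⟩ := exists_eq_C_mul_of_expField (n := aeval e N) hd (by
    rw [hE, hE, ← map_mul, ← map_mul]
    congr 1
    linear_combination hpar)
  have hND' : N = C c' * D := by
    rw [← sub_eq_zero]
    refine hinj _ _ ((hhom i).sub ((hhom j).C_mul c')) ?_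
    rw [map_sub, hc', map_mul, aeval_C]
    simp
  exact hk₀ (hcontra k₀ (by rw [hND', pderiv_C_mul]; ring))

theorem degree_pullback_foliation₂_ne_zero (φ : BirationalMap) :
    (foliation₂.pullback φ).degree ≠ 0 := by
  refine degree_pullback_ne_zero_of_expField foliation₂ ![1, Polynomial.C Polynomial.X,
    Polynomial.X - Polynomial.C (Polynomial.X ^ 2 + 2 * Polynomial.X + 2)] rfl ?_ ?_ ?_ φ
  · simp [foliation₂, expField_C]
  · simp [foliation₂, expField_C, expField_X]
    ring
  · exact fun b c => ⟨b, c + (b ^ 2 + 2 * b + 2), by simp [Polynomial.evalEval],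
      by simp [Polynomial.evalEval]⟩

theorem degree_pullback_foliation₃_ne_zero (φ : BirationalMap) :
    (foliation₃.pullback φ).degree ≠ 0 := by
  have h2 : (Polynomial.C (Polynomial.C (1 / 2)) * 2 : Polynomial (Polynomial ℂ)) = 1 := by
    rw [← map_ofNat Polynomial.C 2, ← map_ofNat Polynomial.C 2, ← Polynomial.C_mul,
      ← Polynomial.C_mul]
    norm_num
  refine degree_pullback_ne_zero_of_expField foliation₃ ![1, Polynomial.X,
    Polynomial.C Polynomial.X + Polynomial.C (Polynomial.C (1 / 2)) * Polynomial.X ^ 2]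
    rfl ?_ ?_ ?_ φ
  · simp [foliation₃, expField_X]
  · simp [foliation₃, expField_C, expField_X, Derivation.leibniz_pow, -one_div]
    linear_combination Polynomial.X ^ 2 * h2
  · exact fun b c => ⟨c - 1 / 2 * b ^ 2, b, by simp [Polynomial.evalEval],
      by simp [Polynomial.evalEval]⟩

end CremonaFoliation

namespace CremonaFoliation

open MvPolynomial

/-! ### Foliations of degree one have an integrating factor -/

/-- A triple proportional to a triple without common factor is a multiple of it. -/
theorem NoCommonFactor.exists_eq_mul {f u : Fin 3 → Poly} (hf : NoCommonFactor f)
    (h : ∀ i j, f i * u j = f j * u i) : ∃ b, ∀ i, u i = b * f i := by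
  classical
  let _ : StrongNormalizationMonoid Poly :=
    UniqueFactorizationMonoid.strongNormalizationMonoid
  let _ : NormalizedGCDMonoid Poly := UniqueFactorizationMonoid.toNormalizedGCDMonoid Poly
  obtain ⟨i₀, hi₀⟩ := hf.exists_ne_zero
  -- `f i₀` divides every `u i₀ * f j`, hence their gcd, which is `u i₀` because the `f j` are
  -- coprime.
  have h1 : f i₀ ∣ Finset.univ.gcd fun j => u i₀ * f j := Finset.dvd_gcd fun j _ => by
    rw [mul_comm, h j i₀]
    exact dvd_mul_right _ _
  have h2 : Associated (Finset.univ.gcd fun j => u i₀ * f j) (u i₀) :=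
    (Finset.gcd_mul_left' Finset.univ f (u i₀)).trans
      (associated_mul_unit_left _ _ (hf _ fun i => Finset.gcd_dvd (Finset.mem_univ i)))
  obtain ⟨b, hb⟩ := h1.trans h2.dvd
  refine ⟨b, fun i => mul_left_cancel₀ hi₀ ?_⟩
  rw [h i₀ i, hb]
  ring

theorem noCommonFactor_X : NoCommonFactor X :=
  noCommonFactor_of_prime ⟨0, X_ne_zero 0⟩ fun _ hq h =>
    not_prime_dvd_X_X hq (by decide : (0 : Fin 3) ≠ 1) (h 0) (h 1)

/-- The proportionality factor of homogeneous triples. -/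
theorem NoCommonFactor.exists_eq_mul_homogeneous {f u : Fin 3 → Poly} (hf : NoCommonFactor f)
    (h : ∀ i j, f i * u j = f j * u i) {m n : ℕ} (hfm : ∀ i, (f i).IsHomogeneous m)
    (hum : ∀ i, (u i).IsHomogeneous (m + n)) : ∃ b, b.IsHomogeneous n ∧ ∀ i, u i = b * f i := by
  obtain ⟨b, hb⟩ := hf.exists_eq_mul h
  obtain ⟨i₀, hi₀⟩ := hf.exists_ne_zero
  refine ⟨b, isHomogeneous_of_mul_add hi₀ (hfm i₀) ?_, hb⟩
  rw [mul_comm, ← hb]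
  exact hum i₀

theorem exists_eq_C_of_isHomogeneous_zero {p : Poly} (hp : p.IsHomogeneous 0) : ∃ c, p = C c :=
  ⟨_, totalDegree_eq_zero_iff_eq_C.1 (Nat.le_zero.1 hp.totalDegree_le)⟩

/-- The linear vector field of matrix `m`. -/
noncomputable def linField (m : Matrix (Fin 3) (Fin 3) ℂ) (i : Fin 3) : Poly :=
  ∑ j, C (m i j) * X j

theorem pderiv_linField (m : Matrix (Fin 3) (Fin 3) ℂ) (i k : Fin 3) :
    pderiv k (linField m i) = C (m i k) := by
  simp [linField, pderiv_X, Pi.single_apply]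

theorem isHomogeneous_linField (m : Matrix (Fin 3) (Fin 3) ℂ) (i : Fin 3) :
    (linField m i).IsHomogeneous 1 :=
  IsHomogeneous.sum _ _ _ fun _ _ => isHomogeneous_C_mul_X _ _

theorem linField_mul (m n : Matrix (Fin 3) (Fin 3) ℂ) (i : Fin 3) :
    linField (m * n) i = ∑ j, C (m i j) * linField n j := by
  simp only [linField, Matrix.mul_apply, map_sum, map_mul, Finset.mul_sum, Finset.sum_mul]
  rw [Finset.sum_comm]
  simp only [mul_assoc]

/-- The cross product of triples of polynomials. -/
noncomputable def cross (u v : Fin 3 → Poly) : Fin 3 → Poly :=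
  ![u 1 * v 2 - u 2 * v 1, u 2 * v 0 - u 0 * v 2, u 0 * v 1 - u 1 * v 0]

theorem cross_zero_iff (u v : Fin 3 → Poly) (h : ∀ i, cross u v i = 0) (i j : Fin 3) :
    u i * v j = u j * v i := by
  have h0 : u 1 * v 2 - u 2 * v 1 = 0 := h 0
  have h1 : u 2 * v 0 - u 0 * v 2 = 0 := h 1
  have h2 : u 0 * v 1 - u 1 * v 0 = 0 := h 2
  fin_cases i <;> fin_cases j <;> simp only [Fin.zero_eta, Fin.mk_one, Fin.reduceFinMk]
  · linear_combination h2
  · linear_combination -h1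
  · linear_combination -h2
  · linear_combination h0
  · linear_combination h1
  · linear_combination -h0

/-- By Euler and the radial relation, contracting `dω` with the radial field gives `3 ω`, with `3 =
2 + 1` as the coefficients are quadratic. So the field can be taken to be minus one third of the
curl of `ω`. -/
theorem Foliation.exists_linField (G : Foliation) (hG : G.degree = 1) :
    ∃ m : Matrix (Fin 3) (Fin 3) ℂ, ∀ i, G.form i = cross X (linField m) i := by
  have h : ∀ i, (G.form i).IsHomogeneous 2 := fun i => by simpa [hG] using G.homogeneous i
  have hlin : ∀ i j k l, ∃ a : Fin 3 → ℂ,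
      pderiv i (G.form j) - pderiv k (G.form l) = ∑ i, C (a i) * X i := fun i j k l => by
    obtain ⟨a, -, ha⟩ := isHomogeneous_one_eq (((h j).pderiv (i := i)).sub ((h l).pderiv (i := k)))
    exact ⟨a, ha⟩
  obtain ⟨a0, ha0⟩ := hlin 2 1 1 2
  obtain ⟨a1, ha1⟩ := hlin 0 2 2 0
  obtain ⟨a2, ha2⟩ := hlin 1 0 0 1
  have he : ∀ i, X 0 * pderiv 0 (G.form i) + X 1 * pderiv 1 (G.form i) +
      X 2 * pderiv 2 (G.form i) = 2 * G.form i := fun i => by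
    have := (h i).sum_X_mul_pderiv
    rw [Fin.sum_univ_three] at this
    rw [this, nsmul_eq_mul, Nat.cast_ofNat]
  have hr : ∀ k, pderiv k (X 0 * G.form 0 + X 1 * G.form 1 + X 2 * G.form 2) = 0 := fun k => by
    have := congrArg (pderiv k) G.radial
    rwa [Fin.sum_univ_three, map_zero] at this
  have hr0 := hr 0
  have hr1 := hr 1
  have hr2 := hr 2
  simp only [map_add, pderiv_mul, pderiv_X_self, pderiv_X_of_ne (by decide : (1 : Fin 3) ≠ 0),
    pderiv_X_of_ne (by decide : (2 : Fin 3) ≠ 0), pderiv_X_of_ne (by decide : (0 : Fin 3) ≠ 1),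
    pderiv_X_of_ne (by decide : (2 : Fin 3) ≠ 1), pderiv_X_of_ne (by decide : (0 : Fin 3) ≠ 2),
    pderiv_X_of_ne (by decide : (1 : Fin 3) ≠ 2)] at hr0 hr1 hr2
  have hm : ∀ i, linField ((1 / 3 : ℂ) • Matrix.of ![a0, a1, a2]) i = C (1 / 3) *
      ![pderiv 2 (G.form 1) - pderiv 1 (G.form 2), pderiv 0 (G.form 2) - pderiv 2 (G.form 0),
        pderiv 1 (G.form 0) - pderiv 0 (G.form 1)] i := fun i => by
    simp only [linField, Matrix.smul_apply, smul_eq_mul, map_mul, mul_assoc, ← Finset.mul_sum]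
    congr 1
    fin_cases i
    · exact ha0.symm
    · exact ha1.symm
    · exact ha2.symm
  have h3 : (C (1 / 3) * 3 : Poly) = 1 := by
    rw [← map_ofNat C 3, ← C_mul]
    norm_num
  refine ⟨(1 / 3 : ℂ) • Matrix.of ![a0, a1, a2], fun i => ?_⟩
  generalize (1 / 3 : ℂ) • Matrix.of ![a0, a1, a2] = m at hm
  have hm0 := hm 0
  have hm1 := hm 1
  have hm2 := hm 2
  simp only [Matrix.cons_val] at hm0 hm1 hm2
  fin_cases i <;> simp only [cross, Fin.zero_eta, Fin.mk_one, Fin.reduceFinMk, Matrix.cons_val]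
  · linear_combination (-G.form 0) * h3 + C (1 / 3) * hr0 - C (1 / 3) * he 0 - X 1 * hm2 +
      X 2 * hm1
  · linear_combination (-G.form 1) * h3 + C (1 / 3) * hr1 - C (1 / 3) * he 1 - X 2 * hm0 +
      X 0 * hm2
  · linear_combination (-G.form 2) * h3 + C (1 / 3) * hr2 - C (1 / 3) * he 2 - X 0 * hm1 +
      X 1 * hm0

/-- `S` is the determinant of `x`, `m x`, `m² x`. These linear fields commute; the form kills the
first two and equals `S` on the third. Divided by `S` it belongs to the dual of a commuting frame,
hence is closed. The proof is the expanded identity. -/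
theorem closed_linField (m : Matrix (Fin 3) (Fin 3) ℂ) (S : Poly)
    (hS : S = ∑ i, cross X (linField m) i * linField (m * m) i) (j k : Fin 3) :
    S * (pderiv k (cross X (linField m) j) - pderiv j (cross X (linField m) k)) =
      pderiv k S * cross X (linField m) j - pderiv j S * cross X (linField m) k := by
  have key : ∀ j k : Fin 3, j < k →
      S * (pderiv k (cross X (linField m) j) - pderiv j (cross X (linField m) k)) =
      pderiv k S * cross X (linField m) j - pderiv j S * cross X (linField m) k := by
    intro j k hjk
    subst hS
    simp only [map_add, Fin.sum_univ_three, pderiv_mul, pderiv_linField]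
    fin_cases j <;> fin_cases k <;> first | exact absurd hjk (by decide) | skip
    all_goals
      simp [cross, pderiv_X, pderiv_linField]
      simp only [linField_mul, Matrix.mul_apply, Fin.sum_univ_three, map_add, map_mul]
      simp only [linField, Fin.sum_univ_three]
      ring
  rcases lt_trichotomy j k with h | h | h
  · exact key j k h
  · subst h; ring
  · linear_combination -key k j h

/-- The quadratic polynomial splits, so two translates of `m` by scalars have product zero; their
ranks add up to at most 3, and one of them is at most 1. -/
theorem exists_rank_one_of_quadratic (m : Matrix (Fin 3) (Fin 3) ℂ) (a b : ℂ)
    (h : m * m = b • m + a • 1) :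
    ∃ (c : ℂ) (v l : Fin 3 → ℂ), ∀ i j, m i j = (c • (1 : Matrix (Fin 3) (Fin 3) ℂ)) i j +
      v i * l j := by
  obtain ⟨c, hc⟩ := exists_quadratic_eq_zero (a := (1 : ℂ)) (b := -b) (c := -a) one_ne_zero
    (IsAlgClosed.exists_eq_mul_self _)
  have hprod : (m - c • 1) * (m - (b - c) • 1) = 0 := by
    have : (m - c • 1) * (m - (b - c) • 1) = m * m - b • m + (c * (b - c)) • 1 := by
      simp only [sub_mul, mul_sub, smul_mul_assoc, mul_smul_comm, one_mul, mul_one, sub_smul,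
        smul_sub, mul_smul, smul_comm b c]
      abel
    rw [this, h, show c * (b - c) = -a by linear_combination -hc]
    simp
  have hrank := Matrix.rank_add_rank_le_card_of_mul_eq_zero hprod
  rw [Fintype.card_fin] at hrank
  have key : ∀ n : Matrix (Fin 3) (Fin 3) ℂ, n.rank ≤ 1 → ∃ v l : Fin 3 → ℂ,
      ∀ i j, n i j = v i * l j := by
    intro n hn
    obtain ⟨v, hv⟩ := finrank_le_one_iff.1 hn
    choose l hl using fun j => hv ⟨n.mulVecLin (Pi.single j 1), LinearMap.mem_range_self _ _⟩
    refine ⟨v, l, fun i j => ?_⟩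
    have := congrFun (congrArg Subtype.val (hl j)) i
    simp at this
    rw [← this, mul_comm]
  rcases le_or_gt (m - c • 1).rank 1 with h1 | h1
  · obtain ⟨v, l, hvl⟩ := key _ h1
    exact ⟨c, v, l, fun i j => by rw [← hvl, Matrix.sub_apply]; ring⟩
  · obtain ⟨v, l, hvl⟩ := key (m - (b - c) • 1) (by omega)
    exact ⟨b - c, v, l, fun i j => by rw [← hvl, Matrix.sub_apply]; ring⟩

/-- If the determinant vanished, `m² x` would be a combination of `x` and `m x` with constant
coefficients, since `x × m x` has no common factor. Then `m` is a scalar plus a matrix of rank at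
most one `v l`, and the linear form `l` divides `x × m x`. -/
theorem Foliation.integratingFactor_ne_zero (G : Foliation) (m : Matrix (Fin 3) (Fin 3) ℂ)
    (hm : ∀ i, G.form i = cross X (linField m) i) :
    ∑ i, cross X (linField m) i * linField (m * m) i ≠ 0 := by
  intro hS
  have hcop : NoCommonFactor (cross X (linField m)) := by
    convert G.coprime using 1
    exact (funext hm).symm
  have hcross : ∀ n i, (cross X (linField n) i).IsHomogeneous 2 := by
    have h := fun i j (n : Matrix (Fin 3) (Fin 3) ℂ) =>
      (isHomogeneous_X ℂ i).mul (isHomogeneous_linField n j)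
    intro n i
    fin_cases i
    · exact (h 1 2 n).sub (h 2 1 n)
    · exact (h 2 0 n).sub (h 0 2 n)
    · exact (h 0 1 n).sub (h 1 0 n)
  -- The proportionality is the identity `(x × m x) × (x × m² x) = S x`.
  obtain ⟨p, hp, hpu⟩ := hcop.exists_eq_mul_homogeneous (u := cross X (linField (m * m)))
    (m := 2) (n := 0) (fun i j => by
      simp only [Fin.sum_univ_three, cross, Matrix.cons_val] at hS
      fin_cases i <;> fin_cases j <;>
        simp only [cross, Fin.zero_eta, Fin.mk_one, Fin.reduceFinMk, Matrix.cons_val]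
      · linear_combination X 2 * hS
      · linear_combination -X 1 * hS
      · linear_combination -X 2 * hS
      · linear_combination X 0 * hS
      · linear_combination X 1 * hS
      · linear_combination -X 0 * hS) (hcross m) (hcross (m * m))
  obtain ⟨b, rfl⟩ := exists_eq_C_of_isHomogeneous_zero hp
  have hlin : ∀ i, linField (m * m - b • m) i = linField (m * m) i - C b * linField m i :=
    fun i => by
      simp only [linField, Fin.sum_univ_three, Matrix.sub_apply, Matrix.smul_apply, smul_eq_mul,
        C_sub, C_mul]
      ring
  obtain ⟨q, hq, hqu⟩ := noCommonFactor_X.exists_eq_mul_homogeneous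
    (u := linField (m * m - b • m)) (m := 1) (n := 0) (cross_zero_iff _ _ fun i => by
      have h0 := hpu 0
      have h1 := hpu 1
      have h2 := hpu 2
      simp only [cross, Matrix.cons_val] at h0 h1 h2
      fin_cases i <;>
        simp only [cross, hlin, Fin.zero_eta, Fin.mk_one, Fin.reduceFinMk, Matrix.cons_val]
      · linear_combination h0
      · linear_combination h1
      · linear_combination h2) (isHomogeneous_X ℂ) (isHomogeneous_linField _)
  obtain ⟨a, rfl⟩ := exists_eq_C_of_isHomogeneous_zero hq
  have hquad : m * m = b • m + a • 1 := by
    rw [← sub_eq_iff_eq_add']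
    ext i k
    have := congrArg (pderiv k) (hqu i)
    rw [pderiv_linField, pderiv_C_mul, pderiv_X] at this
    refine C_injective (Fin 3) ℂ ?_
    rw [this, Matrix.smul_apply, Matrix.one_apply, Pi.single_apply]
    by_cases h : i = k <;> simp [h]
  obtain ⟨c, v, l, hvl⟩ := exists_rank_one_of_quadratic m a b hquad
  have hV : ∀ i, linField m i = C c * X i + C (v i) * ∑ j, C (l j) * X j := fun i => by
    simp only [linField, hvl, Fin.sum_univ_three]
    fin_cases i <;> simp <;> ring
  have hunit := hcop (∑ j, C (l j) * X j) fun i => by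
    fin_cases i <;>
      simp only [cross, hV, Fin.zero_eta, Fin.mk_one, Fin.reduceFinMk, Matrix.cons_val]
    · exact ⟨X 1 * C (v 2) - X 2 * C (v 1), by ring⟩
    · exact ⟨X 2 * C (v 0) - X 0 * C (v 2), by ring⟩
    · exact ⟨X 0 * C (v 1) - X 1 * C (v 0), by ring⟩
  have := hunit.map (eval (0 : Fin 3 → ℂ))
  simp at this

theorem Foliation.exists_integratingFactor (G : Foliation) (hG : G.degree < 2) :
    ∃ (S : Poly) (n : ℕ), S ≠ 0 ∧ S.IsHomogeneous n ∧ ∀ j k,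
      S * (pderiv k (G.form j) - pderiv j (G.form k)) =
        pderiv k S * G.form j - pderiv j S * G.form k := by
  rcases (by omega : G.degree = 0 ∨ G.degree = 1) with h | h
  · exact G.exists_integratingFactor_of_degree_eq_zero h
  · obtain ⟨m, hm⟩ := G.exists_linField h
    refine ⟨_, 3, G.integratingFactor_ne_zero m hm, ?_, fun j k => ?_⟩
    · refine IsHomogeneous.sum _ _ _ fun i _ => ?_
      rw [← hm]
      have := (G.homogeneous i).mul (isHomogeneous_linField (m * m) i)
      rwa [h] at this
    · rw [hm, hm]
      exact closed_linField m _ rfl j k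

end CremonaFoliation

namespace CremonaFoliation

open MvPolynomial

/-! ### From an integrating factor to an invariant curve -/

theorem pderiv_pderiv_comm (i j : Fin 3) (p : Poly) :
    pderiv i (pderiv j p) = pderiv j (pderiv i p) := by
  have h : ⁅(pderiv i : Derivation ℂ Poly Poly), pderiv j⁆ = 0 :=
    MvPolynomial.derivation_ext fun k => by
      rw [Derivation.commutator_apply, pderiv_X, pderiv_X]
      simp only [Pi.single_apply]
      split_ifs <;> simp
  rw [← sub_eq_zero, ← Derivation.commutator_apply, h, Derivation.zero_apply]

/-- The exterior derivative commutes with pull-backs. -/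
theorem pderiv_pullbackForm_sub (f ω : Fin 3 → Poly) (j k : Fin 3) :
    pderiv k (pullbackForm f ω j) - pderiv j (pullbackForm f ω k) =
      ∑ i, ∑ l, bind₁ f (pderiv l (ω i) - pderiv i (ω l)) * pderiv k (f l) * pderiv j (f i) := by
  have h1 : ∀ j k, pderiv k (pullbackForm f ω j) =
      (∑ i, ∑ l, bind₁ f (pderiv l (ω i)) * pderiv k (f l) * pderiv j (f i)) +
        ∑ i, bind₁ f (ω i) * pderiv k (pderiv j (f i)) := by
    intro j k
    simp only [pullbackForm, map_sum, pderiv_mul, pderiv_bind₁, Finset.sum_add_distrib,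
      Finset.sum_mul]
  have h2 : ∀ i, pderiv k (pderiv j (f i)) = pderiv j (pderiv k (f i)) := fun i =>
    pderiv_pderiv_comm _ _ _
  rw [h1, h1]
  simp_rw [h2]
  rw [add_sub_add_right_eq_sub]
  conv_lhs => rw [Finset.sum_comm (f := fun i l => bind₁ f (pderiv l (ω i)) * pderiv j (f l) *
    pderiv k (f i))]
  rw [← Finset.sum_sub_distrib]
  refine Finset.sum_congr rfl fun i _ => ?_
  rw [← Finset.sum_sub_distrib]
  refine Finset.sum_congr rfl fun l _ => ?_
  rw [map_sub]
  ring

/-- Pull-backs of closed rational forms are closed. -/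
theorem closed_pullbackForm (f ω : Fin 3 → Poly) (S : Poly)
    (h : ∀ j k, S * (pderiv k (ω j) - pderiv j (ω k)) = pderiv k S * ω j - pderiv j S * ω k)
    (j k : Fin 3) :
    bind₁ f S * (pderiv k (pullbackForm f ω j) - pderiv j (pullbackForm f ω k)) =
      pderiv k (bind₁ f S) * pullbackForm f ω j - pderiv j (bind₁ f S) * pullbackForm f ω k := by
  rw [pderiv_pullbackForm_sub, pderiv_bind₁, pderiv_bind₁, pullbackForm, pullbackForm,
    Finset.sum_mul_sum, Finset.sum_mul_sum]
  rw [Finset.sum_comm (f := fun i l => bind₁ f (pderiv i S) * pderiv k (f i) *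
    (bind₁ f (ω l) * pderiv j (f l))), ← Finset.sum_sub_distrib, Finset.mul_sum]
  refine Finset.sum_congr rfl fun i _ => ?_
  rw [← Finset.sum_sub_distrib, Finset.mul_sum]
  refine Finset.sum_congr rfl fun l _ => ?_
  have := congrArg (bind₁ f) (h i l)
  simp only [map_mul, map_sub] at this ⊢
  linear_combination pderiv k (f l) * pderiv j (f i) * this

/-- A foliation with a birational model of degree at most one has an invariant curve or is given
by a closed form. -/
theorem Foliation.exists_invariant_of_degree_lt (F : Foliation) (φ : BirationalMap)
    (hφ : (F.pullback φ).degree < 2)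
    (hinv : ∀ (p : Poly) (n : ℕ), p.IsHomogeneous n → p ≠ 0 →
      (∀ j k, p ∣ pderiv k p * F.form j - pderiv j p * F.form k) → n = 0) (j k : Fin 3) :
    pderiv k (F.form j) = pderiv j (F.form k) := by
  obtain ⟨ψ, A, B, a, b, hA, hB, hAa, hBb, hAB, hψ⟩ := (F.isPullback_pullback φ).exists_inverse
  obtain ⟨S, s, hS0, hS, hcl⟩ := (F.pullback φ).exists_integratingFactor hφ
  have hcl := closed_pullbackForm ψ.coord _ S hcl
  set η := pullbackForm ψ.coord (F.pullback φ).form with hη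
  set T := bind₁ ψ.coord S with hT
  have hT0 : T ≠ 0 := hψ S s hS hS0
  have hThom : T.IsHomogeneous (ψ.degree * s) := hS.aeval _ ψ.homogeneous
  -- As `A F = B η` and `η / T` is closed, the form of `F` times `A / (B T)` is closed.
  have hcl2 : ∀ j k, A * (B * T) * (pderiv k (F.form j) - pderiv j (F.form k)) =
      (A * pderiv k (B * T) - (B * T) * pderiv k A) * F.form j -
      (A * pderiv j (B * T) - (B * T) * pderiv j A) * F.form k := by
    intro j k
    have hj := congrArg (pderiv k) (hAB j)
    have hk := congrArg (pderiv j) (hAB k)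
    rw [pderiv_mul, pderiv_mul] at hj hk
    rw [pderiv_mul, pderiv_mul]
    linear_combination B * T * hj - B * T * hk + B * B * hcl j k -
      (T * pderiv k B + B * pderiv k T) * hAB j + (T * pderiv j B + B * pderiv j T) * hAB k
  have hD0 : B * T ≠ 0 := mul_ne_zero hB hT0
  have hDhom : (B * T).IsHomogeneous (b + ψ.degree * s) := hBb.mul hThom
  clear hAB
  generalize B * T = D at *
  obtain ⟨N', D', g, hrel, rfl, rfl⟩ := UniqueFactorizationMonoid.exists_reduced_factors A hA D
  have hg : g ≠ 0 := left_ne_zero_of_mul hA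
  have hN' : N' ≠ 0 := right_ne_zero_of_mul hA
  have hD' : D' ≠ 0 := right_ne_zero_of_mul hD0
  have hcl3 : ∀ j k, N' * D' * (pderiv k (F.form j) - pderiv j (F.form k)) =
      (N' * pderiv k D' - D' * pderiv k N') * F.form j -
      (N' * pderiv j D' - D' * pderiv j N') * F.form k := by
    intro j k
    refine mul_left_cancel₀ (pow_ne_zero 2 hg) ?_
    have := hcl2 j k
    simp only [pderiv_mul] at this
    linear_combination this
  have hNhom := isHomogeneous_of_mul hg hN' hAa
  have hDhom := isHomogeneous_of_mul hg hD' hDhom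
  -- Modulo `N'` the closedness relation reads `D' dN' ∧ ω ≡ 0`, and `D'` is prime to `N'`; so `N' =
  -- 0` is invariant. The same holds for `D'`.
  have h1 := hinv N' _ hNhom hN' fun j k => by
    refine hrel.dvd_of_dvd_mul_left ⟨pderiv k D' * F.form j - pderiv j D' * F.form k -
      D' * (pderiv k (F.form j) - pderiv j (F.form k)), ?_⟩
    linear_combination hcl3 j k
  have h2 := hinv D' _ hDhom hD' fun j k => by
    refine hrel.symm.dvd_of_dvd_mul_left ⟨pderiv k N' * F.form j - pderiv j N' * F.form k +
      N' * (pderiv k (F.form j) - pderiv j (F.form k)), ?_⟩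
    linear_combination -hcl3 j k
  rw [h1] at hNhom
  rw [h2] at hDhom
  obtain ⟨c, rfl⟩ := exists_eq_C_of_isHomogeneous_zero hNhom
  obtain ⟨d, rfl⟩ := exists_eq_C_of_isHomogeneous_zero hDhom
  have h3 := hcl3 j k
  simp only [pderiv_C, mul_zero, sub_self, zero_mul] at h3
  exact sub_eq_zero.1 ((mul_eq_zero.1 h3).resolve_left (mul_ne_zero hN' hD'))

end CremonaFoliation

namespace CremonaFoliation

open PowerSeries

/-! ### The weak separatrix of the saddle-node -/

/-- Contraction principle for the `X`-adic topology: the iterates of `0` stabilize coefficient by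
coefficient. -/
theorem exists_fixedPoint (Φ : ℂ⟦X⟧ → ℂ⟦X⟧)
    (h : ∀ m f g, X ^ m ∣ f - g → X ^ (m + 1) ∣ Φ f - Φ g) : ∃ u, Φ u = u := by
  have h1 : ∀ m k, X ^ m ∣ Φ^[m + k] 0 - Φ^[m] 0 := by
    intro m
    induction m with
    | zero => simp
    | succ m ih =>
      intro k
      rw [show m + 1 + k = (m + k) + 1 by ring, Function.iterate_succ_apply',
        Function.iterate_succ_apply']
      exact h _ _ _ (ih k)
  have h2 : ∀ m, X ^ m ∣ (mk fun n => coeff n (Φ^[n + 1] 0)) - Φ^[m] 0 := by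
    intro m
    rw [X_pow_dvd_iff]
    intro i hi
    obtain ⟨k, rfl⟩ := Nat.exists_eq_add_of_lt hi
    have := X_pow_dvd_iff.1 (h1 (i + 1) k) i (Nat.lt_succ_self i)
    rw [show i + 1 + k = i + k + 1 by ring, map_sub, sub_eq_zero] at this
    rw [map_sub, coeff_mk, this, sub_self]
  -- The `m`-th iterate is correct only below degree `m`, so the coefficient of index `n` is read
  -- off from iterate `n + 1`.
  refine ⟨mk fun n => coeff n (Φ^[n + 1] 0), ?_⟩
  ext n
  have h3 := h n _ _ (h2 n)
  rw [← Function.iterate_succ_apply' Φ] at h3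
  have h4 := X_pow_dvd_iff.1 (dvd_sub h3 (h2 (n + 1))) n (Nat.lt_succ_self n)
  rw [sub_sub_sub_cancel_right, map_sub, sub_eq_zero] at h4
  exact h4

/-- The function `u` such that `x = -y² + y⁵ u(y)` is the weak separatrix of `Ω₄`. -/
theorem exists_separatrix : ∃ u : ℂ⟦X⟧, (1 - X ^ 3 * u) ^ 2 +
    X ^ 3 * (1 - X ^ 3 * u) * u * (-2 + 5 * X ^ 3 * u + X ^ 4 * d⁄dX ℂ u) = u := by
  -- The equation is `Ω₄ = 0` along `x = -y² + y⁵ u(y)`, divided by `y⁵`.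
  refine exists_fixedPoint (fun u => (1 - X ^ 3 * u) ^ 2 +
    X ^ 3 * (1 - X ^ 3 * u) * u * (-2 + 5 * X ^ 3 * u + X ^ 4 * d⁄dX ℂ u)) fun m f g hfg => ?_
  -- Differentiation loses one power of `X`; one of the factors `X` in front of the derivative
  -- restores it.
  have hd : X ^ m ∣ X * (d⁄dX ℂ f - d⁄dX ℂ g) := by
    obtain ⟨e, he⟩ := hfg
    rw [← map_sub, he, Derivation.leibniz, derivative_pow, derivative_X]
    cases m with
    | zero => simp
    | succ m => exact ⟨X * d⁄dX ℂ e + ((m : ℂ⟦X⟧) + 1) * e, by simp; ring⟩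
  have key : ((1 - X ^ 3 * f) ^ 2 +
      X ^ 3 * (1 - X ^ 3 * f) * f * (-2 + 5 * X ^ 3 * f + X ^ 4 * d⁄dX ℂ f)) -
      ((1 - X ^ 3 * g) ^ 2 +
      X ^ 3 * (1 - X ^ 3 * g) * g * (-2 + 5 * X ^ 3 * g + X ^ 4 * d⁄dX ℂ g)) =
      X * ((f - g) * (X ^ 2 * (-2 + X ^ 3 * (f + g) + (-2 + X ^ 4 * d⁄dX ℂ g) +
        (5 - (-2 + X ^ 4 * d⁄dX ℂ g)) * X ^ 3 * (f + g) -
        5 * X ^ 6 * (f ^ 2 + f * g + g ^ 2))) +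
      X * (d⁄dX ℂ f - d⁄dX ℂ g) * (X ^ 5 * (f - X ^ 3 * f ^ 2))) := by
    ring
  change X ^ (m + 1) ∣ ((1 - X ^ 3 * f) ^ 2 + _) - _
  rw [key, pow_succ']
  exact mul_dvd_mul_left _ (dvd_add (hfg.mul_right _) (hd.mul_right _))

/-- The relations between the degree, the cofactor and the order along the weak separatrix of an
invariant curve of `Ω₄`. -/
theorem cofactor_relations {u h q : ℂ⟦X⟧} (hu : (1 - X ^ 3 * u) ^ 2 +
    X ^ 3 * (1 - X ^ 3 * u) * u * (-2 + 5 * X ^ 3 * u + X ^ 4 * d⁄dX ℂ u) = u)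
    {w w' a : ℂ⟦X⟧} (hw : w = X ^ 2 * (-1 + X ^ 3 * u))
    (hw' : w' = -2 * X + 5 * X ^ 4 * u + X ^ 5 * d⁄dX ℂ u)
    (ha : a = 1 - 2 * w * X + (2 * w + X ^ 2) * w' + X ^ 6 * (-1 + X ^ 3 * u) * u)
    {n k e : ℕ} {α β γ : ℂ} (hh : h = X ^ e * q) (hq : constantCoeff q ≠ 0)
    (heq : (k : ℂ⟦X⟧) * a * h + X ^ 7 * u * (1 - X ^ 3 * u) * d⁄dX ℂ h =
      (C (n / 4 : ℂ) * (1 - 4 * w * X) + C α * w + C β * X + C γ) * h) :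
    (n / 4 + γ = (k : ℂ)) ∧ n = 4 * k ∧ e + n = 12 * k := by
  obtain ⟨r, hr⟩ : ∃ r, u = 1 + X ^ 3 * r := ⟨-2 * u + X ^ 3 * u ^ 2 +
    (1 - X ^ 3 * u) * u * (-2 + 5 * X ^ 3 * u + X ^ 4 * d⁄dX ℂ u), by
      linear_combination -hu⟩
  have hX : (X : ℂ⟦X⟧) ≠ 0 := X_ne_zero
  have hqi : q * q⁻¹ = 1 := PowerSeries.mul_inv_cancel _ hq
  have hdh : X * d⁄dX ℂ h = X ^ e * ((e : ℂ⟦X⟧) * q + X * d⁄dX ℂ q) := by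
    rw [hh, Derivation.leibniz, derivative_pow, derivative_X]
    cases e with
    | zero => simp
    | succ m => simp; ring
  have h4 : (C (n / 4 : ℂ) * 4 : ℂ⟦X⟧) = n := by
    rw [← map_ofNat C 4, ← map_mul, div_mul_cancel₀ _ (by norm_num), map_natCast]
  have h1 : (C (n / 4 : ℂ) * (1 - 4 * w * X) + C α * w + C β * X + C γ - (k : ℂ⟦X⟧) * a) * q =
      X ^ 6 * u * (1 - X ^ 3 * u) * ((e : ℂ⟦X⟧) * q + X * d⁄dX ℂ q) := by
    refine mul_left_cancel₀ (pow_ne_zero e hX) ?_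
    rw [hh] at heq
    rw [hh] at hdh
    linear_combination -heq + X ^ 6 * u * (1 - X ^ 3 * u) * hdh
  -- Division by `h = Xᵉ q`: the logarithmic derivative of `h` has residue `e`.
  have h2 : C (n / 4 : ℂ) * (1 - 4 * w * X) + C α * w + C β * X + C γ - (k : ℂ⟦X⟧) * a =
      X ^ 6 * u * (1 - X ^ 3 * u) * ((e : ℂ⟦X⟧) + X * (d⁄dX ℂ q * q⁻¹)) := by
    linear_combination q⁻¹ * h1 - (C (n / 4 : ℂ) * (1 - 4 * w * X) + C α * w + C β * X + C γ -
      (k : ℂ⟦X⟧) * a - X ^ 6 * u * (1 - X ^ 3 * u) * (e : ℂ⟦X⟧)) * hqi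
  -- Modulo `X⁷` one has `u X⁶ ≡ X⁶`, `w ≡ -X² + X⁵` up to a term in `X⁸`, and `a ≡ 1 + 4 X³ - 12
  -- X⁶`. The unknowns `α`, `β` do not enter the coefficients of degrees 0, 3 and 6.
  have h3 : X ^ 7 ∣ C ((n : ℂ) / 4 + γ - k) + C β * X ^ 1 + C (-α) * X ^ 2 +
      C ((n : ℂ) - 4 * k) * X ^ 3 + C α * X ^ 5 + C (12 * (k : ℂ) - n - e) * X ^ 6 := by
    clear heq hu h1 hdh
    generalize d⁄dX ℂ u = u' at *
    generalize d⁄dX ℂ q * q⁻¹ = y at *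
    subst hw hw' ha hr
    refine ⟨-C α * (X * r) + (n : ℂ⟦X⟧) * (X ^ 2 * r) +
      (k : ℂ⟦X⟧) * (-12 * X ^ 2 * r - u' + 11 * X ^ 2 * (1 + X ^ 3 * r) ^ 2 +
        2 * X ^ 3 * (1 + X ^ 3 * r) * u') + y +
      X ^ 2 * (r - (1 + X ^ 3 * r) ^ 2) * ((e : ℂ⟦X⟧) + X * y), ?_⟩
    simp only [map_add, map_sub, map_neg, map_mul, map_natCast, map_ofNat]
    linear_combination h2 + X ^ 3 * (-1 + X ^ 3 * (1 + X ^ 3 * r)) * h4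
  have key : ∀ z₀ z₁ z₂ z₃ z₅ z₆ : ℂ, X ^ 7 ∣ C z₀ + C z₁ * X ^ 1 + C z₂ * X ^ 2 + C z₃ * X ^ 3 +
      C z₅ * X ^ 5 + C z₆ * X ^ 6 → z₀ = 0 ∧ z₃ = 0 ∧ z₆ = 0 := by
    intro z₀ z₁ z₂ z₃ z₅ z₆ h
    rw [X_pow_dvd_iff] at h
    have c0 := h 0 (by norm_num)
    have c3 := h 3 (by norm_num)
    have c6 := h 6 (by norm_num)
    simp only [map_add, coeff_C_mul, coeff_X_pow, coeff_C] at c0 c3 c6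
    norm_num at c0 c3 c6
    exact ⟨c0, c3, c6⟩
  obtain ⟨c0, c3, c6⟩ := key _ _ _ _ _ _ h3
  refine ⟨sub_eq_zero.1 c0, by exact_mod_cast sub_eq_zero.1 c3, ?_⟩
  have : (e : ℂ) + n = 12 * k := by linear_combination -c6
  exact_mod_cast this

end CremonaFoliation

namespace CremonaFoliation

open MvPolynomial

/-! ### The fourth foliation has no invariant curve -/

/-- The cofactor of an invariant curve of the fourth foliation in the chart `z = 1`. -/
theorem exists_cofactor_foliation₄ {F : Poly} {n : ℕ} (hF : F.IsHomogeneous n) (hn : n ≠ 0)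
    (h0 : F ≠ 0) (h : ∀ j k, F ∣ pderiv k F * foliation₄.form j - pderiv j F * foliation₄.form k) :
    ∃ a : Fin 3 → ℂ, pderiv 0 F * foliation₄.form 1 - pderiv 1 F * foliation₄.form 0 =
      F * (C (n / 4 : ℂ) * (X 2 ^ 2 - 4 * (X 0 * X 1)) + (∑ i, C (a i) * X i) * X 2) := by
  obtain ⟨n, rfl⟩ := Nat.exists_eq_succ_of_ne_zero hn
  obtain ⟨t0, ht0⟩ := h 2 1
  obtain ⟨t1, ht1⟩ := h 0 2
  obtain ⟨t2, ht2⟩ := h 1 0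
  have hhom : ∀ j k t, pderiv k F * foliation₄.form j - pderiv j F * foliation₄.form k = F * t →
      t.IsHomogeneous 2 := by
    intro j k t ht
    refine isHomogeneous_of_mul_add h0 hF ?_
    rw [← ht]
    have := fun j k => (hF.pderiv (i := k)).mul (foliation₄.homogeneous j)
    exact ((this j k).sub (this k j))
  have he : X 0 * pderiv 0 F + X 1 * pderiv 1 F + X 2 * pderiv 2 F = ((n : Poly) + 1) * F := by
    have := hF.sum_X_mul_pderiv
    rw [Fin.sum_univ_three] at this
    rw [this, nsmul_eq_mul, Nat.cast_succ]
  have hr : X 0 * foliation₄.form 0 + X 1 * foliation₄.form 1 + X 2 * foliation₄.form 2 = 0 := by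
    have := foliation₄.radial
    rwa [Fin.sum_univ_three] at this
  have h4 : (C (((n.succ : ℕ) : ℂ) / 4) * 4 : Poly) = (n : Poly) + 1 := by
    rw [← map_ofNat C 4, ← C_mul, div_mul_cancel₀ _ (by norm_num), Nat.cast_succ, C_add, C_1,
      map_natCast]
  set ν : ℂ := ((n.succ : ℕ) : ℂ) / 4
  -- Contracting `dF ∧ ω = F t` with the radial field: the cross product of `x` and `t` is minus the
  -- degree times `ω`.
  have hc0 : X 1 * t2 - X 2 * t1 = -((n : Poly) + 1) * foliation₄.form 0 := by
    refine mul_left_cancel₀ h0 ?_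
    linear_combination -X 1 * ht2 + X 2 * ht1 + pderiv 0 F * hr - foliation₄.form 0 * he
  have hc1 : X 2 * t0 - X 0 * t2 = -((n : Poly) + 1) * foliation₄.form 1 := by
    refine mul_left_cancel₀ h0 ?_
    linear_combination -X 2 * ht0 + X 0 * ht2 + pderiv 1 F * hr - foliation₄.form 1 * he
  have hc2 : X 0 * t1 - X 1 * t0 = -((n : Poly) + 1) * foliation₄.form 2 := by
    refine mul_left_cancel₀ h0 ?_
    linear_combination -X 0 * ht1 + X 1 * ht0 + pderiv 2 F * hr - foliation₄.form 2 * he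
  have hX := isHomogeneous_X ℂ (σ := Fin 3)
  -- A particular solution is `ν` times the curl of `ω`, because contracting `dω` with the radial
  -- field gives `4 ω`. The difference is parallel to `x`, hence a linear form times `x`.
  obtain ⟨l, hl, hlu⟩ := noCommonFactor_X.exists_eq_mul_homogeneous (m := 1) (n := 1)
    (u := ![t0 + C ν * (3 * (X 0 * X 2) + 4 * X 1 ^ 2), t1 - C ν * (4 * X 0 ^ 2 + X 1 * X 2),
      t2 - C ν * (X 2 ^ 2 - 4 * (X 0 * X 1))])
    (cross_zero_iff _ _ fun i => by
      simp only [foliation₄, Matrix.cons_val] at hc0 hc1 hc2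
      fin_cases i <;> simp only [cross, Fin.zero_eta, Fin.mk_one, Fin.reduceFinMk, Matrix.cons_val]
      · linear_combination hc0 + X 0 * (X 0 * X 2 + X 1 ^ 2) * h4
      · linear_combination hc1 + (X 0 * X 2 ^ 2 + X 1 ^ 2 * X 2 - X 0 ^ 2 * X 1) * h4
      · linear_combination hc2 - (X 0 ^ 3 + X 0 * X 1 * X 2 + X 1 ^ 3) * h4)
    hX fun i => by
      fin_cases i
      · exact (hhom _ _ _ ht0).add (((((hX 0).mul (hX 2)).C_mul 3).add
          (((hX 1).pow 2).C_mul 4)).C_mul ν)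
      · exact (hhom _ _ _ ht1).sub (((((hX 0).pow 2).C_mul 4).add
          ((hX 1).mul (hX 2))).C_mul ν)
      · exact (hhom _ _ _ ht2).sub ((((hX 2).pow 2).sub
          (((hX 0).mul (hX 1)).C_mul 4)).C_mul ν)
  obtain ⟨a, -, rfl⟩ := isHomogeneous_one_eq hl
  refine ⟨a, ?_⟩
  have := hlu 2
  simp only [Matrix.cons_val] at this
  rw [ht2]
  linear_combination F * this

/-- The lowest order term in `t` of a homogeneous polynomial at `(t (s + v), t, 1)`, where `v` is a
power series in `t` without constant term. -/
theorem exists_lowest_term {F : Poly} {n : ℕ} (hF : F.IsHomogeneous n) (h0 : F ≠ 0)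
    {v : PowerSeries ℂ} (hv : PowerSeries.constantCoeff v = 0) :
    ∃ (m : ℕ) (g : Polynomial (PowerSeries ℂ)), m ≤ n ∧
      g.map PowerSeries.constantCoeff ≠ 0 ∧
      aeval ![Polynomial.C PowerSeries.X * (Polynomial.X + Polynomial.C v),
        Polynomial.C PowerSeries.X, 1] F = Polynomial.C PowerSeries.X ^ m * g := by
  -- Monomials of highest degree in `z` are those of lowest degree in `(x, y)`: `m = d₀ 0 + d₀ 1` is
  -- the multiplicity of the curve at `(0 : 0 : 1)`.
  obtain ⟨d₀, hd₀, hmax⟩ := F.support.exists_max_image (fun d => d 2)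
    (Finset.nonempty_iff_ne_empty.2 (by rwa [Ne, MvPolynomial.support_eq_empty]))
  have hdeg : ∀ d ∈ F.support, d 0 + d 1 + d 2 = n := fun d hd => by
    have := hF (MvPolynomial.mem_support_iff.1 hd)
    rw [weight_one_eq, Finsupp.degree_eq_sum, Fin.sum_univ_three] at this
    exact this
  have h2 := hdeg d₀ hd₀
  set t : Polynomial (PowerSeries ℂ) := Polynomial.C PowerSeries.X
  refine ⟨d₀ 0 + d₀ 1, ∑ d ∈ F.support, Polynomial.C (PowerSeries.C (coeff d F)) *
    (Polynomial.X + Polynomial.C v) ^ d 0 * t ^ (d₀ 2 - d 2), by omega, fun hz => ?_, ?_⟩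
  -- At `t = 0` only the monomials with maximal exponent of `z` survive; their exponents of `x` are
  -- distinct, so they do not cancel.
  · have h3 := congrArg (fun p => p.coeff (d₀ 0)) hz
    simp only [Polynomial.map_sum, Polynomial.map_mul, Polynomial.map_pow, Polynomial.map_add,
      Polynomial.map_X, Polynomial.map_C, hv, t, PowerSeries.constantCoeff_X, map_zero, add_zero,
      PowerSeries.constantCoeff_C, Polynomial.finsetSum_coeff, Polynomial.coeff_zero] at h3
    rw [Finset.sum_eq_single d₀] at h3
    · simp at h3
      exact MvPolynomial.mem_support_iff.1 hd₀ h3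
    · intro d hd hne
      by_cases hd2 : d 2 = d₀ 2
      · have : d 0 ≠ d₀ 0 := fun hd0 => hne (by
          have := hdeg d hd
          ext i
          fin_cases i
          · exact hd0
          · change d 1 = d₀ 1
            omega
          · exact hd2)
        simp [hd2, Polynomial.coeff_X_pow, Ne.symm this]
      · rw [zero_pow (by have := hmax d hd; omega), mul_zero, Polynomial.coeff_zero]
    · exact fun h => absurd hd₀ h
  · rw [aeval_def, eval₂_eq', Finset.mul_sum]
    refine Finset.sum_congr rfl fun d hd => ?_
    have h3 := hdeg d hd
    have h4 := hmax d hd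
    rw [Fin.prod_univ_three]
    simp only [Matrix.cons_val, one_pow, mul_one]
    have h5 : t ^ (d 0) * t ^ (d 1) = t ^ (d₀ 0 + d₀ 1) * t ^ (d₀ 2 - d 2) := by
      rw [← pow_add, ← pow_add]
      congr 1
      omega
    rw [mul_pow]
    change Polynomial.C (PowerSeries.C (coeff d F)) * _ = _
    linear_combination Polynomial.C (PowerSeries.C (coeff d F)) *
      (Polynomial.X + Polynomial.C v) ^ d 0 * h5

end CremonaFoliation

/-! ### Restriction of an invariant curve to the separatrix and to the exceptional divisor. -/

namespace CremonaFoliation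

open Polynomial

/-- The equation of an invariant curve of the fourth foliation with the cofactor given by `ν` and
`a`, in the coordinates `(s, t)` such that `x = t (s + v)`, `y = t`, `x = t v` being the weak
separatrix. -/
theorem invariant_equation {u : PowerSeries ℂ} (hu : (1 - PowerSeries.X ^ 3 * u) ^ 2 +
      PowerSeries.X ^ 3 * (1 - PowerSeries.X ^ 3 * u) * u * (-2 + 5 * PowerSeries.X ^ 3 * u +
        PowerSeries.X ^ 4 * PowerSeries.derivative ℂ u) = u) {F : Poly} {ν : ℂ} {a : Fin 3 → ℂ}
    (ha : MvPolynomial.pderiv 0 F * foliation₄.form 1 - MvPolynomial.pderiv 1 F * foliation₄.form 0 =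
      F * (MvPolynomial.C ν * (MvPolynomial.X 2 ^ 2 - 4 * (MvPolynomial.X 0 * MvPolynomial.X 1)) +
        (∑ i, MvPolynomial.C (a i) * MvPolynomial.X i) * MvPolynomial.X 2))
    {T U U' V p : (PowerSeries ℂ)[X]} (hT : T = C PowerSeries.X) (hU : U = C u)
    (hU' : U' = C (PowerSeries.derivative ℂ u)) (hV : V = T * (-1 + T ^ 3 * U))
    (hp : p = MvPolynomial.aeval ![T * (X + V), T, 1] F) :
    X * (1 - 2 * (T * V) * T - X * T ^ 2 +
        (2 * (T * V) + T ^ 2) * (-2 * T + 5 * T ^ 4 * U + T ^ 5 * U') +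
        X * T * (-2 * T + 5 * T ^ 4 * U + T ^ 5 * U') + T ^ 6 * (-1 + T ^ 3 * U) * U +
        X * (2 * (T * V) + T ^ 2) + X ^ 2 * T) * derivative p -
      T ^ 2 * ((X + V) * (X + V + T)) * coeffDerivation (PowerSeries.derivative ℂ) p =
    (C (PowerSeries.C ν) * (1 - 4 * (T * (X + V)) * T) + C (PowerSeries.C (a 0)) * (T * (X + V)) +
      C (PowerSeries.C (a 1)) * T + C (PowerSeries.C (a 2))) * p := by
  have hUeq : (1 - T ^ 3 * U) ^ 2 + T ^ 3 * (1 - T ^ 3 * U) * U *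
      (-2 + 5 * T ^ 3 * U + T ^ 4 * U') = U := by
    have := congrArg (C : PowerSeries ℂ → (PowerSeries ℂ)[X]) hu
    simpa only [hT, hU, hU', map_add, map_mul, map_sub, map_pow, map_neg, map_one,
      map_ofNat] using this
  obtain ⟨Ds, hDs⟩ : ∃ D : Derivation ℂ (PowerSeries ℂ)[X] (PowerSeries ℂ)[X],
      D = (derivative' (R := PowerSeries ℂ)).restrictScalars ℂ := ⟨_, rfl⟩
  obtain ⟨Dt, hDt⟩ : ∃ D, D = coeffDerivation (PowerSeries.derivative ℂ) := ⟨_, rfl⟩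
  have hDsp : ∀ p, derivative p = Ds p := fun p => by rw [hDs]; rfl
  have hDsS : Ds X = 1 := by rw [← hDsp, derivative_X]
  have hDsT : Ds T = 0 := by rw [← hDsp, hT, derivative_C]
  have hDsU : Ds U = 0 := by rw [← hDsp, hU, derivative_C]
  have hDtS : Dt X = 0 := by rw [hDt, coeffDerivation_X]
  have hDtT : Dt T = 1 := by
    rw [hDt, hT, coeffDerivation_C, PowerSeries.derivative_X, map_one]
  have hDtU : Dt U = U' := by rw [hDt, hU, coeffDerivation_C, hU']
  rw [hDsp, ← hDt]
  have hDsV : Ds V = 0 := by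
    rw [hV]
    simp [Derivation.leibniz, Derivation.leibniz_pow, hDsT, hDsU]
  have hDtV : Dt V = -1 + 4 * T ^ 3 * U + T ^ 4 * U' := by
    rw [hV]
    simp only [Derivation.leibniz, Derivation.leibniz_pow, map_add, map_neg,
      Derivation.map_one_eq_zero, hDtT, hDtU, smul_eq_mul, nsmul_eq_mul]
    push_cast
    ring
  have h0 : Ds (T * (X + V)) = T := by
    simp only [Derivation.leibniz, map_add, hDsS, hDsT, hDsV, smul_eq_mul]
    ring
  have h1 : Dt (T * (X + V)) = X + V + T * (-1 + 4 * T ^ 3 * U + T ^ 4 * U') := by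
    simp only [Derivation.leibniz, map_add, hDtS, hDtT, hDtV, smul_eq_mul]
    ring
  have hs := derivation_aeval Ds ![T * (X + V), T, 1] F
  have ht := derivation_aeval Dt ![T * (X + V), T, 1] F
  have hK := congrArg (MvPolynomial.aeval ![T * (X + V), T, 1]) ha
  have hC : ∀ c : ℂ, algebraMap ℂ (PowerSeries ℂ)[X] c = C (PowerSeries.C c) := fun c => rfl
  simp only [foliation₄, map_add, map_sub, map_mul, map_pow, MvPolynomial.aeval_X,
    Fin.sum_univ_three, MvPolynomial.aeval_C, map_ofNat, Matrix.cons_val, hC] at hK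
  simp only [Fin.sum_univ_three, Matrix.cons_val, h0, h1, hDsT, hDtT,
    Derivation.map_one_eq_zero] at hs ht
  rw [hp, hs, ht]
  generalize MvPolynomial.aeval ![T * (X + V), T, 1] (MvPolynomial.pderiv 0 F) = P at *
  generalize MvPolynomial.aeval ![T * (X + V), T, 1] (MvPolynomial.pderiv 1 F) = Q at *
  generalize MvPolynomial.aeval ![T * (X + V), T, 1] F = R at *
  subst hV
  -- The part of the transformed field that would prevent `s = 0` from being invariant is, up to
  -- sign, `T⁵` times the separatrix equation.
  linear_combination hK + T ^ 5 * P * hUeq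

/-- The restriction to `s = 0` of a polynomial killed by a vector field tangent to `s = 0`. -/
theorem restrict_equation {R : Type*} [CommRing R] [Algebra ℂ R] (d : Derivation ℂ R R)
    {A B K p h : R[X]} {k : ℕ} (hp : p = X ^ k * h)
    (heq : X * A * derivative p - B * coeffDerivation d p = K * p) :
    k * A.coeff 0 * h.coeff 0 - B.coeff 0 * d (h.coeff 0) = K.coeff 0 * h.coeff 0 := by
  have h1 : X * derivative p = X ^ k * ((k : R[X]) * h + X * derivative h) := by
    rw [hp, derivative_mul]
    cases k with
    | zero => simp
    | succ k => simp; ring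
  have h2 : coeffDerivation d p = X ^ k * coeffDerivation d h := by
    rw [hp, Derivation.leibniz, Derivation.leibniz_pow, coeffDerivation_X]
    simp
  have h3 : A * ((k : R[X]) * h + X * derivative h) - B * coeffDerivation d h = K * h := by
    refine ((isRegular_X_pow k).left : IsLeftRegular (X ^ k : R[X])) ?_
    change X ^ k * _ = X ^ k * _
    rw [h2] at heq
    rw [hp] at heq h1
    linear_combination heq - A * h1
  have h4 := congrArg (fun q : R[X] => q.coeff 0) h3
  simp only [coeff_sub, mul_coeff_zero, coeff_add, coeff_X_zero, zero_mul, add_zero,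
    natCast_coeff_zero, coeff_coeffDerivation] at h4
  linear_combination h4

/-- The restriction to `t = 0` of a polynomial killed by a vector field tangent to `t = 0`. -/
theorem initial_equation {A B K p g : (PowerSeries ℂ)[X]} {m : ℕ}
    (hp : p = C PowerSeries.X ^ m * g)
    (heq : X * A * derivative p - C PowerSeries.X ^ 2 * B *
      coeffDerivation (PowerSeries.derivative ℂ) p = K * p) :
    X * A.map PowerSeries.constantCoeff * derivative (g.map PowerSeries.constantCoeff) =
      K.map PowerSeries.constantCoeff * g.map PowerSeries.constantCoeff := by
  have hT : (C PowerSeries.X : (PowerSeries ℂ)[X]) ≠ 0 := C_ne_zero.2 PowerSeries.X_ne_zero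
  have h1 : C PowerSeries.X * coeffDerivation (PowerSeries.derivative ℂ) p =
      C PowerSeries.X ^ m * ((m : (PowerSeries ℂ)[X]) * g +
        C PowerSeries.X * coeffDerivation (PowerSeries.derivative ℂ) g) := by
    rw [hp, Derivation.leibniz, Derivation.leibniz_pow, coeffDerivation_C,
      PowerSeries.derivative_X]
    cases m with
    | zero => simp
    | succ m => simp; ring
  have h2 : derivative p = C PowerSeries.X ^ m * derivative g := by
    rw [hp, ← C_pow, derivative_C_mul]
  have h3 : X * A * derivative g - C PowerSeries.X * (B * ((m : (PowerSeries ℂ)[X]) * g +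
      C PowerSeries.X * coeffDerivation (PowerSeries.derivative ℂ) g)) = K * g := by
    refine mul_left_cancel₀ (pow_ne_zero m hT) ?_
    rw [h2] at heq
    rw [hp] at heq h1
    linear_combination heq + C PowerSeries.X * B * h1
  have h4 := congrArg (Polynomial.map PowerSeries.constantCoeff) h3
  simpa only [Polynomial.map_sub, Polynomial.map_mul, map_C, map_X, PowerSeries.constantCoeff_X,
    map_zero, zero_mul, sub_zero, derivative_map] using h4

/-- An invariant curve of the fourth foliation has degree zero. -/
theorem foliation₄_no_invariant {F : Poly} {n : ℕ} (hF : F.IsHomogeneous n) (h0 : F ≠ 0)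
    (h : ∀ j k, F ∣ MvPolynomial.pderiv k F * foliation₄.form j -
      MvPolynomial.pderiv j F * foliation₄.form k) : n = 0 := by
  by_contra hn
  obtain ⟨a, ha⟩ := exists_cofactor_foliation₄ hF hn h0 h
  obtain ⟨u, hu⟩ := exists_separatrix
  obtain ⟨v, hv⟩ : ∃ v : PowerSeries ℂ, v = PowerSeries.X * (-1 + PowerSeries.X ^ 3 * u) :=
    ⟨_, rfl⟩
  have hv0 : PowerSeries.constantCoeff v = 0 := by simp [hv]
  obtain ⟨m, g, hmn, hg, hm⟩ := exists_lowest_term hF h0 hv0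
  obtain ⟨p, hp⟩ : ∃ p : (PowerSeries ℂ)[X],
      p = MvPolynomial.aeval ![C PowerSeries.X * (X + C v), C PowerSeries.X, 1] F := ⟨_, rfl⟩
  have heq := invariant_equation hu ha (T := C PowerSeries.X) (U := C u)
    (U' := C (PowerSeries.derivative ℂ u)) (V := C v) (p := p) rfl rfl rfl
    (by rw [hv]; simp) hp
  rw [← hp] at hm
  have hp0 : p ≠ 0 := by
    rw [hm]
    exact mul_ne_zero (pow_ne_zero m (C_ne_zero.2 PowerSeries.X_ne_zero))
      (fun hz : g = 0 => hg (by rw [hz, Polynomial.map_zero]))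
  have hinit := initial_equation hm (B := (X + C v) * (X + C v + C PowerSeries.X)) heq
  -- Here `k` is the multiplicity of the separatrix in the curve, possibly zero.
  obtain ⟨b, hb, hndvd⟩ := exists_eq_pow_rootMultiplicity_mul_and_not_dvd p hp0 0
  generalize rootMultiplicity 0 p = k at hb
  rw [C_0, sub_zero] at hb hndvd
  have hb0 : b.coeff 0 ≠ 0 := fun h => hndvd (X_dvd_iff.2 h)
  have hres := restrict_equation (PowerSeries.derivative ℂ) hb heq
  obtain ⟨e, q, hq, hbq⟩ : ∃ (e : ℕ) (q : PowerSeries ℂ), PowerSeries.constantCoeff q ≠ 0 ∧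
      b.coeff 0 = PowerSeries.X ^ e * q := by
    obtain ⟨q, hq⟩ := PowerSeries.X_pow_order_dvd (φ := b.coeff 0)
    refine ⟨(b.coeff 0).order.toNat, q, fun h => PowerSeries.coeff_order hb0 ?_, hq⟩
    have := PowerSeries.coeff_X_pow_mul q (b.coeff 0).order.toNat 0
    rwa [← hq, zero_add, PowerSeries.coeff_zero_eq_constantCoeff_apply, h] at this
  obtain ⟨hk, hnk, he⟩ := cofactor_relations (n := n) (k := k) (α := a 0) (β := a 1) (γ := a 2)
    hu rfl rfl rfl hbq hq (by
      have h4 : ((4 : (PowerSeries ℂ)[X])).coeff 0 = 4 := coeff_ofNat_zero 4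
      have h2 : ((2 : (PowerSeries ℂ)[X])).coeff 0 = 2 := coeff_ofNat_zero 2
      have h5 : ((5 : (PowerSeries ℂ)[X])).coeff 0 = 5 := coeff_ofNat_zero 5
      simp only [mul_coeff_zero, coeff_add, coeff_sub, coeff_X_zero, coeff_C_zero, ← C_pow,
        coeff_neg, coeff_one_zero, h4, h2, h5, pow_two] at hres
      rw [hv] at hres
      linear_combination hres)
  -- On `t = 0` the field is `s ∂/∂s` and the cofactor is the constant `n / 4 + γ = k`; so the
  -- restriction of `g` is a multiple of `sᵏ`.
  have hA : X * derivative (g.map PowerSeries.constantCoeff) =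
      C (k : ℂ) * g.map PowerSeries.constantCoeff := by
    rw [← hk]
    simpa [hv0] using hinit
  have hgk : (g.map PowerSeries.constantCoeff).coeff k ≠ 0 := by
    obtain ⟨i, hi⟩ := Polynomial.ext_iff.not.1 hg |> not_forall.1
    rw [coeff_zero] at hi
    have := congrArg (fun q : ℂ[X] => q.coeff i) hA
    have hik : (i : ℂ) = k := by
      refine mul_right_cancel₀ hi ?_
      cases i with
      | zero => simpa using this
      | succ i =>
        simp only [coeff_X_mul, coeff_derivative, coeff_C_mul] at this
        push_cast
        linear_combination this
    rwa [← Nat.cast_injective (R := ℂ) hik]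
  -- The coefficient of `sᵏ` in `p` is `tᵉ q`, and its term in `tᵐ` is the coefficient of `sᵏ` in
  -- `g` at `t = 0`, which is nonzero.
  have hem : e ≤ m := by
    by_contra! hlt
    have h1 : p.coeff k = PowerSeries.X ^ e * q := by
      rw [hb, ← hbq, coeff_X_pow_mul', if_pos le_rfl, Nat.sub_self]
    rw [hm, ← C_pow, coeff_C_mul] at h1
    have h2 := congrArg (PowerSeries.coeff m) h1
    rw [PowerSeries.coeff_X_pow_mul', if_pos le_rfl, PowerSeries.coeff_X_pow_mul',
      if_neg hlt.not_ge, Nat.sub_self, PowerSeries.coeff_zero_eq_constantCoeff_apply] at h2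
    exact hgk (by rw [coeff_map, h2])
  -- `e = 8k`, `n = 4k` and `e ≤ m ≤ n` leave only `n = 0`.
  omega

end CremonaFoliation

/-! ### Assembly of the proposition. -/

theorem mainTheorem4 :
    ((∃ ψ ∈ CremonaFoliation.orbit CremonaFoliation.rho, ψ.degree = 2 ∧
          (CremonaFoliation.foliation₁.pullback ψ).degree = 2) ∧
        CremonaFoliation.foliation₁.HasRationalFirstIntegral ∧
        ¬ CremonaFoliation.foliation₁.IsPrimitive) ∧
      ((¬ ∃ φ : CremonaFoliation.BirationalMap,
          (CremonaFoliation.foliation₂.pullback φ).degree = 0) ∧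
        (∃ ψ ∈ CremonaFoliation.orbit CremonaFoliation.tau,
          (CremonaFoliation.foliation₂.pullback ψ).degree = 1) ∧
        ¬ CremonaFoliation.foliation₂.IsPrimitive) ∧
      ((¬ ∃ φ : CremonaFoliation.BirationalMap,
          (CremonaFoliation.foliation₃.pullback φ).degree = 0) ∧
        (∃ ψ ∈ CremonaFoliation.orbit CremonaFoliation.tau,
          (CremonaFoliation.foliation₃.pullback ψ).degree = 1) ∧
        ¬ CremonaFoliation.foliation₃.IsPrimitive) ∧
      ((∃ ψ ∈ CremonaFoliation.orbit CremonaFoliation.tau, ψ.degree = 2 ∧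
          (CremonaFoliation.foliation₄.pullback ψ).degree = 3) ∧
        CremonaFoliation.foliation₄.IsPrimitive) := by
  open CremonaFoliation in
  have not_primitive : ∀ (F : Foliation) (φ : BirationalMap) (G : Foliation), IsPullback φ F G →
      G.degree < F.degree → ¬ F.IsPrimitive := fun F φ G hG hlt hF =>
    absurd (hF φ) (by rw [degree_pullback_eq hG]; exact hlt.not_ge)
  refine ⟨⟨⟨_, CremonaFoliation.linComp_mem_orbit CremonaFoliation.matrix₁ _, rfl,
    CremonaFoliation.degree_pullback_eq CremonaFoliation.isPullback₁⟩,
    CremonaFoliation.foliation₁_hasRationalFirstIntegral,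
    not_primitive _ _ _ CremonaFoliation.isPullback_shear two_pos⟩,
    ⟨fun ⟨φ, hφ⟩ => CremonaFoliation.degree_pullback_foliation₂_ne_zero φ hφ,
      ⟨_, CremonaFoliation.linComp_mem_orbit CremonaFoliation.matrix₂ _,
        CremonaFoliation.degree_pullback_eq CremonaFoliation.isPullback₂⟩,
      not_primitive _ _ _ CremonaFoliation.isPullback₂ one_lt_two⟩,
    ⟨fun ⟨φ, hφ⟩ => CremonaFoliation.degree_pullback_foliation₃_ne_zero φ hφ,
      ⟨_, CremonaFoliation.linComp_mem_orbit CremonaFoliation.matrix₃ _,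
        CremonaFoliation.degree_pullback_eq CremonaFoliation.isPullback₃⟩,
      not_primitive _ _ _ CremonaFoliation.isPullback₃ one_lt_two⟩,
    ⟨_, CremonaFoliation.linComp_mem_orbit CremonaFoliation.matrix₄ _, rfl,
      CremonaFoliation.degree_pullback_eq CremonaFoliation.isPullback₄⟩, fun φ => ?_⟩
  by_contra hlt
  have hd := CremonaFoliation.foliation₄.exists_invariant_of_degree_lt φ (not_le.1 hlt)
    (fun p n hp hp0 h => CremonaFoliation.foliation₄_no_invariant hp hp0 h) 0 1
  -- At `(0, 0, 1)` the two partial derivatives are `0` and `1`, so the form is not closed.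
  have := congrArg (MvPolynomial.eval ![0, 0, 1]) hd
  simp [CremonaFoliation.foliation₄, MvPolynomial.pderiv_X, Derivation.leibniz,
    Derivation.leibniz_pow] at this
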